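/- Let $H\in\mathbb{C}[x,y]$, let $\Sigma_H\subset\mathbb{C}$ be the set of atypical values of $H$ (critical values, and values over no neighbourhood of which $H:\mathbb{C}^2\to\mathbb{C}$ is a locally trivial fibration), let $t_0\notin\Sigma_H$, $p_0\in H^{-1}(t_0)$, and let $\gamma\subset H^{-1}(t_0)$ be a loop at $p_0$. Put $\pi=\pi_1(H^{-1}(t_0),p_0)$, with lower central series $L_1=\pi$, $L_{i+1}=[L_i,\pi]$ (and $L_0=\pi$). Let $\mathcal{O}\subset\pi$ be the subgroup generated by the orbit of $\gamma$ under monodromy, i.e. by the images of $\gamma$ under parallel transport, through loops in the fibres of $H$, along all loops at $p_0$ in $\mathbb{C}^2\setminus H^{-1}(\Sigma_H)$. Given free generators $\delta_1,\dots,\delta_m$ of $\pi$, let $\mathcal{A}$ be the free differential $\mathbb{C}$-algebra (commutative, with unit) on symbols $m_j(\delta_i)$, $1\le i\le m$, $j\ge1$, and $\mathcal{A}_k\subset\mathcal{A}$ the differential subalgebra generated by those with $j\le k$. Formal series $\mathrm{id}+f$, $f\in\epsilon\mathcal{A}[[\epsilon]]$, form a group under the composition $$(\mathrm{id}+f)\circ(\mathrm{id}+g)=\mathrm{id}+g+\sum_{i\ge0}\frac{f^{(i)}}{i!}g^i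 ,$$ and we let $\delta\mapsto \mathrm{id}+\sum_{j\ge1}\epsilon^j m_j(\delta)$ be the map from $\pi$ to this group with $\delta_i\mapsto \mathrm{id}+\sum_{j\ge1}\epsilon^jm_j(\delta_i)$ that sends the loop "first $\alpha$, then $\beta$" to the image of $\beta$ composed with the image of $\alpha$; this defines $m_j(\delta)\in\mathcal{A}$ for all $\delta\in\pi$. Theorem. For each $k\in\mathbb{N}$ there is $n\in\mathbb{N}$, depending only on $H$, $\gamma$ and $k$, with the following property. Let $\delta_1,\dots,\delta_m$ be free generators of $\pi$ and, for each $q\ge1$, let $\{\sigma_{q,q'}\}_{1\le q'\le d_q}\subset\mathcal{O}\cap L_q$ be a finite collection generating $(\mathcal{O}\cap L_q)/(\mathcal{O}\cap L_{q+1})$. Then for all $\ell\ge0$, all $\delta\in\mathcal{O}\cap L_\ell$ and all $1\le j\le\ell+k-1$, the element $m_j(\delta)$ lies in $\mathcal{A}_k$, and some power $m_j(\delta)^d$, $d\ge1$, lies in the differential ideal of $\mathcal{A}_k$ generated by the finitely many elements $m_{j'}(\sigma_{q,q'})$ with $1\le q\le n$, $1\le q'\le d_q$ and $q\le j'\le q+k-1$.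 -/

import Mathlib

open scoped Differential
open Finset (range)

/-! ## Composition of formal series `id + ∑_{j ≥ 1} ε ^ j f_j` over a differential ring

The parameter `ε` is the variable `PowerSeries.X`, and a derivation `f ↦ f′` of the coefficient
ring plays the role of `d/dt`. -/

section Truncation

variable {R : Type*} [CommRing R]

theorem eq_of_X_pow_dvd {f g : PowerSeries R} (h : ∀ N, PowerSeries.X ^ N ∣ f - g) : f = g := by
  ext n
  have := PowerSeries.X_pow_dvd_iff.1 (h (n + 1)) n (Nat.lt_succ_self n)
  rwa [map_sub, sub_eq_zero] at this

theorem X_pow_dvd_sub_triangle {F : ℕ → ℕ → PowerSeries R}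
    (hF : ∀ i j, PowerSeries.X ^ (i + j) ∣ F i j) (N : ℕ) :
    PowerSeries.X ^ N ∣ (∑ i ∈ range N, ∑ j ∈ range N, F i j) -
      ∑ n ∈ range N, ∑ p ∈ Finset.HasAntidiagonal.antidiagonal n, F p.1 p.2 := by
  have h : ∑ n ∈ range N, ∑ p ∈ Finset.HasAntidiagonal.antidiagonal n, F p.1 p.2 =
      ∑ p ∈ (range N ×ˢ range N).filter (fun p => p.1 + p.2 < N), F p.1 p.2 := by
    rw [Finset.sum_sigma']
    refine Finset.sum_nbij' (fun x => x.2) (fun p => ⟨p.1 + p.2, p⟩) ?_ ?_ ?_ ?_ ?_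
    · rintro ⟨n, i, j⟩ h; simp at h ⊢; omega
    · rintro ⟨i, j⟩ h; simp at h ⊢; omega
    · rintro ⟨n, i, j⟩ h; simp at h ⊢; omega
    · rintro ⟨i, j⟩ h; rfl
    · rintro ⟨n, i, j⟩ h; rfl
  rw [h, ← Finset.sum_product', ← Finset.sum_filter_add_sum_filter_not (range N ×ˢ range N)
    (fun p => p.1 + p.2 < N), add_sub_cancel_left]
  refine Finset.dvd_sum fun p hp => (pow_dvd_pow _ ?_).trans (hF p.1 p.2)
  simpa using (Finset.mem_filter.1 hp).2

end Truncation

section SeriesDeriv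

variable {R : Type*} [CommRing R] [Differential R]

/-- The `i`-th derivative of a formal series in `ε`, taken coefficientwise. -/
noncomputable def seriesDeriv (i : ℕ) (f : PowerSeries R) : PowerSeries R :=
  PowerSeries.mk fun n => (fun x : R => x′)^[i] (PowerSeries.coeff n f)

theorem seriesDeriv_add (i : ℕ) (f g : PowerSeries R) :
    seriesDeriv i (f + g) = seriesDeriv i f + seriesDeriv i g := by
  ext n; simp [seriesDeriv]

theorem seriesDeriv_zero_left (f : PowerSeries R) : seriesDeriv 0 f = f := by
  ext n; simp [seriesDeriv]

theorem seriesDeriv_seriesDeriv (i j : ℕ) (f : PowerSeries R) :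
    seriesDeriv i (seriesDeriv j f) = seriesDeriv (i + j) f := by
  ext n; simp [seriesDeriv, Function.iterate_add_apply]

theorem seriesDeriv_one_mul (f g : PowerSeries R) :
    seriesDeriv 1 (f * g) = seriesDeriv 1 f * g + f * seriesDeriv 1 g := by
  ext n
  simp only [seriesDeriv, PowerSeries.coeff_mk, Function.iterate_one, PowerSeries.coeff_mul,
    map_sum, map_add, Derivation.leibniz, smul_eq_mul, ← Finset.sum_add_distrib]
  exact Finset.sum_congr rfl fun x _ => by ring

/-- `seriesDeriv i` as an additive map. -/
noncomputable def seriesDerivHom (i : ℕ) : PowerSeries R →+ PowerSeries R :=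
  AddMonoidHom.mk' (seriesDeriv i) (seriesDeriv_add i)

theorem seriesDeriv_sum {ι : Type*} (i : ℕ) (s : Finset ι) (f : ι → PowerSeries R) :
    seriesDeriv i (∑ j ∈ s, f j) = ∑ j ∈ s, seriesDeriv i (f j) :=
  map_sum (seriesDerivHom i) f s

theorem X_pow_dvd_seriesDeriv {N : ℕ} {f : PowerSeries R} (i : ℕ) (h : PowerSeries.X ^ N ∣ f) :
    PowerSeries.X ^ N ∣ seriesDeriv i f := by
  rw [PowerSeries.X_pow_dvd_iff] at h ⊢
  intro m hm
  simp [seriesDeriv, h m hm]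

end SeriesDeriv

section Composition

variable {R : Type*} [CommRing R] [Differential R] [Algebra ℚ R]

theorem seriesDeriv_smul (i : ℕ) (q : ℚ) (f : PowerSeries R) :
    seriesDeriv i (q • f) = q • seriesDeriv i f :=
  map_rat_smul (seriesDerivHom i) q f

/-- The partial sum `∑_{i < N} f^(i) g ^ i / i!` of the Taylor expansion of `f ∘ (id + g)`. -/
noncomputable def taylorSum (N : ℕ) (f g : PowerSeries R) : PowerSeries R :=
  ∑ i ∈ range N, ((i.factorial : ℚ)⁻¹) • (seriesDeriv i f * g ^ i)

/-- The Taylor expansion `f ∘ (id + g) = ∑_i f^(i) g ^ i / i!`. Here `g` has no constant term in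
`ε`, so that only the terms with `i ≤ n` contribute to the coefficient of `ε ^ n`. -/
noncomputable def taylorComp (f g : PowerSeries R) : PowerSeries R :=
  PowerSeries.mk fun n => PowerSeries.coeff n (taylorSum (n + 1) f g)

/-- The divided derivative `f^(i) / i!`, an auxiliary notion for the proofs below. -/
noncomputable def divDeriv (i : ℕ) (f : PowerSeries R) : PowerSeries R :=
  ((i.factorial : ℚ)⁻¹) • seriesDeriv i f

theorem divDeriv_succ (i : ℕ) (f : PowerSeries R) :
    ((i + 1 : ℕ) : ℚ) • divDeriv (i + 1) f = seriesDeriv 1 (divDeriv i f) := by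
  have h : ((i + 1 : ℕ) : ℚ) ≠ 0 := by positivity
  rw [divDeriv, divDeriv, seriesDeriv_smul, seriesDeriv_seriesDeriv, smul_smul, add_comm 1 i,
    Nat.factorial_succ, Nat.cast_mul, mul_inv, mul_inv_cancel_left₀ h]

theorem divDeriv_mul (n : ℕ) (f g : PowerSeries R) :
    divDeriv n (f * g) =
      ∑ p ∈ Finset.HasAntidiagonal.antidiagonal n, divDeriv p.1 f * divDeriv p.2 g := by
  induction n with
  | zero => simp [divDeriv, seriesDeriv_zero_left]
  | succ n ih =>
    have h0 : ((n + 1 : ℕ) : ℚ) ≠ 0 := by positivity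
    refine smul_right_injective _ h0 ?_
    dsimp only
    rw [divDeriv_succ, ih, seriesDeriv_sum, Finset.smul_sum]
    have h1 : ∀ p ∈ Finset.HasAntidiagonal.antidiagonal (n + 1),
        ((n + 1 : ℕ) : ℚ) • (divDeriv p.1 f * divDeriv p.2 g) =
          ((p.1 : ℚ) • divDeriv p.1 f) * divDeriv p.2 g +
            divDeriv p.1 f * ((p.2 : ℚ) • divDeriv p.2 g) := by
      intro p hp
      rw [← Finset.HasAntidiagonal.mem_antidiagonal.1 hp, Nat.cast_add, add_smul, smul_mul_assoc, mul_smul_comm]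
    rw [Finset.sum_congr rfl h1, Finset.sum_add_distrib, Finset.Nat.sum_antidiagonal_succ,
      Finset.Nat.sum_antidiagonal_succ']
    simp only [Nat.cast_zero, zero_smul, zero_mul, mul_zero, zero_add, divDeriv_succ,
      seriesDeriv_one_mul, Finset.sum_add_distrib]

theorem divDeriv_divDeriv (i j : ℕ) (f : PowerSeries R) :
    divDeriv i (divDeriv j f) = ((i + j).choose i : ℚ) • divDeriv (i + j) f := by
  rw [divDeriv, divDeriv, divDeriv, seriesDeriv_smul, seriesDeriv_seriesDeriv, smul_smul,
    smul_smul, Nat.cast_add_choose]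
  congr 1
  have := Nat.cast_ne_zero (R := ℚ).2 (i + j).factorial_ne_zero
  field_simp

theorem taylorSum_eq (N : ℕ) (f g : PowerSeries R) :
    taylorSum N f g = ∑ i ∈ range N, divDeriv i f * g ^ i := by
  simp [taylorSum, divDeriv]

theorem X_pow_dvd_taylorComp_sub {g : PowerSeries R} (hg : PowerSeries.X ∣ g) (f : PowerSeries R)
    (N : ℕ) : PowerSeries.X ^ N ∣ taylorComp f g - taylorSum N f g := by
  rw [PowerSeries.X_pow_dvd_iff]
  intro n hn
  obtain ⟨k, rfl⟩ := Nat.exists_eq_add_of_le (Nat.succ_le_of_lt hn)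
  rw [map_sub, taylorComp, PowerSeries.coeff_mk, taylorSum_eq, taylorSum_eq,
    Finset.sum_range_add _ n.succ k, map_add, sub_add_cancel_left, neg_eq_zero]
  have : PowerSeries.X ^ (n + 1) ∣ ∑ i ∈ range k, divDeriv (n.succ + i) f * g ^ (n.succ + i) :=
    Finset.dvd_sum fun i _ => Dvd.dvd.mul_left
      ((pow_dvd_pow_of_dvd hg (n + 1)).trans (pow_dvd_pow _ (by omega))) _
  exact PowerSeries.X_pow_dvd_iff.1 this n (Nat.lt_succ_self n)

theorem taylorComp_add (f₁ f₂ g : PowerSeries R) :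
    taylorComp (f₁ + f₂) g = taylorComp f₁ g + taylorComp f₂ g := by
  ext n
  simp [taylorComp, taylorSum, seriesDeriv_add, add_mul, Finset.sum_add_distrib]

/-- `f ↦ f ∘ (id + g)` as an additive map. -/
noncomputable def taylorCompHom (g : PowerSeries R) : PowerSeries R →+ PowerSeries R :=
  AddMonoidHom.mk' (fun f => taylorComp f g) fun f₁ f₂ => taylorComp_add f₁ f₂ g

theorem X_pow_dvd_divDeriv {N : ℕ} {f : PowerSeries R} (i : ℕ) (h : PowerSeries.X ^ N ∣ f) :
    PowerSeries.X ^ N ∣ divDeriv i f := by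
  rw [divDeriv, Algebra.smul_def]
  exact (X_pow_dvd_seriesDeriv i h).mul_left _

theorem X_pow_dvd_taylorComp {N : ℕ} {f g : PowerSeries R} (hg : PowerSeries.X ∣ g)
    (h : PowerSeries.X ^ N ∣ f) : PowerSeries.X ^ N ∣ taylorComp f g := by
  rw [← sub_add_cancel (taylorComp f g) (taylorSum N f g)]
  refine dvd_add (X_pow_dvd_taylorComp_sub hg f N) ?_
  rw [taylorSum_eq]
  exact Finset.dvd_sum fun i _ => (X_pow_dvd_divDeriv i h).mul_right _

theorem taylorComp_mul {g : PowerSeries R} (hg : PowerSeries.X ∣ g) (f₁ f₂ : PowerSeries R) :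
    taylorComp (f₁ * f₂) g = taylorComp f₁ g * taylorComp f₂ g := by
  refine eq_of_X_pow_dvd fun N => ?_
  have h1 := X_pow_dvd_taylorComp_sub hg (f₁ * f₂) N
  have h2 := X_pow_dvd_taylorComp_sub hg f₁ N
  have h3 := X_pow_dvd_taylorComp_sub hg f₂ N
  have h4 : PowerSeries.X ^ N ∣ taylorSum N f₁ g * taylorSum N f₂ g -
      taylorSum N (f₁ * f₂) g := by
    have := X_pow_dvd_sub_triangle
      (F := fun i j => (divDeriv i f₁ * g ^ i) * (divDeriv j f₂ * g ^ j)) (fun i j => by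
        rw [pow_add]
        exact mul_dvd_mul ((pow_dvd_pow_of_dvd hg i).mul_left _)
          ((pow_dvd_pow_of_dvd hg j).mul_left _)) N
    convert this using 2
    · rw [taylorSum_eq, taylorSum_eq, Finset.sum_mul_sum]
    · rw [taylorSum_eq]
      refine Finset.sum_congr rfl fun n _ => ?_
      rw [divDeriv_mul, Finset.sum_mul]
      refine Finset.sum_congr rfl fun p hp => ?_
      rw [← Finset.HasAntidiagonal.mem_antidiagonal.1 hp]
      ring
  have h5 := (((h1.sub h4).sub (h2.mul_right (taylorComp f₂ g))).sub
    (h3.mul_left (taylorSum N f₁ g)))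
  convert h5 using 1
  ring

theorem taylorComp_pow {g : PowerSeries R} (hg : PowerSeries.X ∣ g) (f : PowerSeries R) (n : ℕ) :
    taylorComp (f ^ (n + 1)) g = taylorComp f g ^ (n + 1) := by
  induction n with
  | zero => simp
  | succ n ih => rw [pow_succ, taylorComp_mul hg, ih, pow_succ _ (n + 1)]

theorem taylorComp_smul (q : ℚ) (f g : PowerSeries R) :
    taylorComp (q • f) g = q • taylorComp f g :=
  map_rat_smul (taylorCompHom g) q f

theorem divDeriv_zero_left (f : PowerSeries R) : divDeriv 0 f = f := by
  simp [divDeriv, seriesDeriv_zero_left]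

theorem taylorComp_mul_pow {g : PowerSeries R} (hg : PowerSeries.X ∣ g) (a f : PowerSeries R)
    (n : ℕ) : taylorComp (a * f ^ n) g = taylorComp a g * taylorComp f g ^ n := by
  cases n with
  | zero => simp
  | succ n => rw [taylorComp_mul hg, taylorComp_pow hg]

theorem taylorComp_taylorComp {f g h : PowerSeries R} (hg : PowerSeries.X ∣ g)
    (hh : PowerSeries.X ∣ h) :
    taylorComp (taylorComp f g) h = taylorComp f (h + taylorComp g h) := by
  refine eq_of_X_pow_dvd fun N => ?_
  have hgh : PowerSeries.X ∣ taylorComp g h := by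
    simpa using X_pow_dvd_taylorComp (N := 1) hh (by simpa using hg)
  have h1 : PowerSeries.X ^ N ∣ taylorComp (taylorComp f g) h - taylorComp (taylorSum N f g) h := by
    have := X_pow_dvd_taylorComp hh (X_pow_dvd_taylorComp_sub hg f N)
    rwa [show taylorComp (taylorComp f g - taylorSum N f g) h = _ from
      map_sub (taylorCompHom h) _ _] at this
  have h2 : taylorComp (taylorSum N f g) h =
      ∑ i ∈ range N, taylorComp (divDeriv i f) h * taylorComp g h ^ i := by
    rw [taylorSum_eq, show taylorComp (∑ i ∈ range N, divDeriv i f * g ^ i) h = _ from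
      map_sum (taylorCompHom h) _ _]
    exact Finset.sum_congr rfl fun i _ => taylorComp_mul_pow hh _ _ _
  have h3 : PowerSeries.X ^ N ∣ (∑ i ∈ range N, taylorComp (divDeriv i f) h * taylorComp g h ^ i) -
      ∑ i ∈ range N, taylorSum N (divDeriv i f) h * taylorComp g h ^ i := by
    rw [← Finset.sum_sub_distrib]
    refine Finset.dvd_sum fun i _ => ?_
    rw [← sub_mul]
    exact (X_pow_dvd_taylorComp_sub hh _ N).mul_right _
  have h4 := X_pow_dvd_sub_triangle
    (F := fun i j => (((i + j).choose i : ℕ) : PowerSeries R) * divDeriv (i + j) f *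
      (taylorComp g h ^ i * h ^ j)) (fun i j => by
        rw [pow_add]
        exact (mul_dvd_mul (pow_dvd_pow_of_dvd hgh i) (pow_dvd_pow_of_dvd hh j)).mul_left _) N
  have h5 : ∑ i ∈ range N, taylorSum N (divDeriv i f) h * taylorComp g h ^ i =
      ∑ i ∈ range N, ∑ j ∈ range N, (((i + j).choose i : ℕ) : PowerSeries R) *
        divDeriv (i + j) f * (taylorComp g h ^ i * h ^ j) := by
    refine Finset.sum_congr rfl fun i _ => ?_
    rw [taylorSum_eq, Finset.sum_mul]
    refine Finset.sum_congr rfl fun j _ => ?_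
    rw [divDeriv_divDeriv, add_comm j i, ← Nat.choose_symm_add, Nat.cast_smul_eq_nsmul,
      nsmul_eq_mul]
    ring
  have h6 : taylorSum N f (h + taylorComp g h) =
      ∑ n ∈ range N, ∑ p ∈ Finset.HasAntidiagonal.antidiagonal n,
        (((p.1 + p.2).choose p.1 : ℕ) : PowerSeries R) * divDeriv (p.1 + p.2) f *
          (taylorComp g h ^ p.1 * h ^ p.2) := by
    rw [taylorSum_eq]
    refine Finset.sum_congr rfl fun n _ => ?_
    rw [add_comm h, add_pow, Finset.Nat.sum_antidiagonal_eq_sum_range_succ_mk, Finset.mul_sum]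
    refine Finset.sum_congr rfl fun i hi => ?_
    have : i + (n - i) = n := by
      have := Finset.mem_range.1 hi
      omega
    simp only [this]
    ring
  have h7 := X_pow_dvd_taylorComp_sub (dvd_add hh hgh) f N
  rw [h6] at h7
  rw [h2] at h1
  rw [h5] at h3
  have := ((h1.add h3).add h4).sub h7
  convert this using 1
  ring

theorem taylorComp_sub (f₁ f₂ g : PowerSeries R) :
    taylorComp (f₁ - f₂) g = taylorComp f₁ g - taylorComp f₂ g :=
  map_sub (taylorCompHom g) f₁ f₂

theorem X_pow_dvd_taylorComp_sub_self {N : ℕ} {f g : PowerSeries R} (hg : PowerSeries.X ∣ g)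
    (h : PowerSeries.X ^ N ∣ f) : PowerSeries.X ^ (N + 1) ∣ taylorComp f g - f := by
  have h1 := X_pow_dvd_taylorComp_sub hg f (N + 1)
  have h2 : PowerSeries.X ^ (N + 1) ∣ taylorSum (N + 1) f g - f := by
    rw [taylorSum_eq, Finset.sum_range_succ', divDeriv_zero_left, pow_zero, mul_one,
      add_sub_cancel_right]
    refine Finset.dvd_sum fun i _ => ?_
    rw [pow_succ]
    exact mul_dvd_mul (X_pow_dvd_divDeriv _ h) (hg.trans (dvd_pow_self g i.succ_ne_zero))
  simpa using h1.add h2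

theorem taylorComp_zero_right (f : PowerSeries R) : taylorComp f 0 = f := by
  refine eq_of_X_pow_dvd fun N => ?_
  cases N with
  | zero => simp
  | succ N =>
    have h := X_pow_dvd_taylorComp_sub (dvd_zero PowerSeries.X) f (N + 1)
    rwa [taylorSum_eq, Finset.sum_range_succ', divDeriv_zero_left, Finset.sum_eq_zero, zero_add,
      pow_zero, mul_one] at h
    intro i _
    simp

/-- Successive approximations of the left inverse of `id + g` under composition. -/
noncomputable def leftInvApprox (g : PowerSeries R) : ℕ → PowerSeries R
  | 0 => 0
  | n + 1 => leftInvApprox g n - (g + taylorComp (leftInvApprox g n) g)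

/-- The series `f` such that `(id + f) ∘ (id + g) = id`. -/
noncomputable def leftInv (g : PowerSeries R) : PowerSeries R :=
  PowerSeries.mk fun n => PowerSeries.coeff n (leftInvApprox g (n + 1))

theorem X_pow_dvd_leftInvApprox_succ_sub {g : PowerSeries R} (hg : PowerSeries.X ∣ g) (n : ℕ) :
    PowerSeries.X ^ (n + 1) ∣ leftInvApprox g (n + 1) - leftInvApprox g n := by
  induction n with
  | zero =>
    have h : taylorComp (0 : PowerSeries R) g = 0 := map_zero (taylorCompHom g)
    simpa [leftInvApprox, h] using hg
  | succ n ih =>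
    have h := X_pow_dvd_taylorComp_sub_self hg ih
    rw [taylorComp_sub] at h
    rw [← dvd_neg]
    convert h using 1
    rw [leftInvApprox, leftInvApprox]
    ring

theorem X_pow_dvd_leftInvApprox_sub {g : PowerSeries R} (hg : PowerSeries.X ∣ g) (n k : ℕ) :
    PowerSeries.X ^ (n + 1) ∣ leftInvApprox g (n + k) - leftInvApprox g n := by
  induction k with
  | zero => simp
  | succ k ih =>
    have h := (pow_dvd_pow PowerSeries.X (show n + 1 ≤ n + k + 1 by omega)).trans
      (X_pow_dvd_leftInvApprox_succ_sub hg (n + k))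
    have := ih.add h
    rwa [sub_add_sub_cancel'] at this

theorem X_pow_dvd_leftInv_sub {g : PowerSeries R} (hg : PowerSeries.X ∣ g) (n : ℕ) :
    PowerSeries.X ^ n ∣ leftInv g - leftInvApprox g n := by
  rw [PowerSeries.X_pow_dvd_iff]
  intro m hm
  obtain ⟨k, rfl⟩ := Nat.exists_eq_add_of_le (Nat.succ_le_of_lt hm)
  have := PowerSeries.X_pow_dvd_iff.1 (X_pow_dvd_leftInvApprox_sub hg (m + 1) k) m (by omega)
  rw [map_sub] at this ⊢
  rw [leftInv, PowerSeries.coeff_mk, ← neg_sub, neg_eq_zero]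
  exact this

theorem X_dvd_leftInv {g : PowerSeries R} (hg : PowerSeries.X ∣ g) :
    PowerSeries.X ∣ leftInv g := by
  have h1 := X_pow_dvd_leftInv_sub hg 1
  have h2 := X_pow_dvd_leftInvApprox_succ_sub hg 0
  simpa [leftInvApprox] using h1.add h2

theorem add_taylorComp_leftInv {g : PowerSeries R} (hg : PowerSeries.X ∣ g) :
    g + taylorComp (leftInv g) g = 0 := by
  refine eq_of_X_pow_dvd fun N => ?_
  have h1 := X_pow_dvd_taylorComp hg (X_pow_dvd_leftInv_sub hg N)
  have h2 := (pow_dvd_pow _ N.le_succ).trans (X_pow_dvd_leftInvApprox_succ_sub hg N)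
  rw [taylorComp_sub] at h1
  convert h1.sub h2 using 1
  rw [leftInvApprox]
  ring

end Composition

/-- Formal series `id + ∑_{j ≥ 1} ε ^ j f_j` with coefficients `f_j` in a differential ring `R`.
Such a series is recorded by its part `f = ∑_{j ≥ 1} ε ^ j f_j`. -/
@[ext]
structure FormalDiffeo (R : Type*) [CommRing R] where
  /-- The series `∑_{j ≥ 1} ε ^ j f_j`. -/
  toSeries : PowerSeries R
  X_dvd : PowerSeries.X ∣ toSeries

namespace FormalDiffeo

variable {R : Type*} [CommRing R] [Differential R] [Algebra ℚ R]

/-- The series form a group under composition,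
`(id + f) ∘ (id + g) = id + (g + f ∘ (id + g))`. -/
noncomputable instance : Group (FormalDiffeo R) where
  mul F G := ⟨G.toSeries + taylorComp F.toSeries G.toSeries, dvd_add G.X_dvd (by
    simpa using X_pow_dvd_taylorComp (N := 1) G.X_dvd (by simpa using F.X_dvd))⟩
  one := ⟨0, dvd_zero _⟩
  inv G := ⟨leftInv G.toSeries, X_dvd_leftInv G.X_dvd⟩
  mul_assoc F G K := by
    apply FormalDiffeo.ext
    change K.toSeries + taylorComp (G.toSeries + taylorComp F.toSeries G.toSeries) K.toSeries =
      (K.toSeries + taylorComp G.toSeries K.toSeries) +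
        taylorComp F.toSeries (K.toSeries + taylorComp G.toSeries K.toSeries)
    rw [taylorComp_add, taylorComp_taylorComp G.X_dvd K.X_dvd, add_assoc]
  one_mul G := by
    apply FormalDiffeo.ext
    change G.toSeries + taylorComp 0 G.toSeries = G.toSeries
    rw [show taylorComp (0 : PowerSeries R) G.toSeries = 0 from map_zero (taylorCompHom _),
      add_zero]
  mul_one F := by
    apply FormalDiffeo.ext
    change 0 + taylorComp F.toSeries 0 = F.toSeries
    rw [taylorComp_zero_right, zero_add]
  inv_mul_cancel G := FormalDiffeo.ext (add_taylorComp_leftInv G.X_dvd)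

theorem toSeries_mul (F G : FormalDiffeo R) :
    (F * G).toSeries = G.toSeries + taylorComp F.toSeries G.toSeries := rfl

theorem toSeries_one : (1 : FormalDiffeo R).toSeries = 0 := rfl

end FormalDiffeo

/-! ## Differential ideals and free differential algebras -/

/-- The differential ideal generated by a set `S`: the ideal generated by all the derivatives
`s^(α)`, `α ≥ 0`, of the elements of `S`. -/
def differentialIdeal {R : Type*} [CommRing R] [Differential R] (S : Set R) : Ideal R :=
  Ideal.span {x | ∃ s ∈ S, ∃ α : ℕ, x = (fun y : R => y′)^[α] s}

theorem subset_differentialIdeal {R : Type*} [CommRing R] [Differential R] (S : Set R) :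
    S ⊆ differentialIdeal S :=
  fun s hs => Ideal.subset_span ⟨s, hs, 0, rfl⟩

theorem deriv_mem_differentialIdeal {R : Type*} [CommRing R] [Differential R] {S : Set R} {x : R}
    (hx : x ∈ differentialIdeal S) : x′ ∈ differentialIdeal S := by
  induction hx using Submodule.span_induction with
  | mem x h =>
    obtain ⟨s, hs, α, rfl⟩ := h
    exact Ideal.subset_span ⟨s, hs, α + 1, (Function.iterate_succ_apply' _ _ _).symm⟩
  | zero => rw [map_zero]; exact zero_mem _
  | add x y _ _ hx hy => rw [map_add]; exact add_mem hx hy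
  | smul a x hx hx' =>
    rw [smul_eq_mul, Derivation.leibniz, smul_eq_mul, smul_eq_mul]
    exact add_mem (Ideal.mul_mem_left _ _ hx') (Ideal.mul_mem_right _ _ hx)

theorem differentialIdeal_le {R : Type*} [CommRing R] [Differential R] {S : Set R} {I : Ideal R}
    (hS : S ⊆ I) (hI : ∀ x ∈ I, x′ ∈ I) : differentialIdeal S ≤ I := by
  refine Ideal.span_le.2 ?_
  rintro _ ⟨s, hs, α, rfl⟩
  induction α with
  | zero => exact hS hs
  | succ α ih => rw [Function.iterate_succ_apply']; exact hI _ ih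

/-- The free differential algebra `𝒜` with unit over `ℂ` on the symbols `m_j(δ_i)`,
`1 ≤ i ≤ m`, `j ≥ 1`. The variable with index `(i, j, α)` is the derivative `m_j(δ_i)^(α)`. -/
abbrev FreeDiffAlg (m : ℕ) : Type := MvPolynomial (Fin m × ℕ+ × ℕ) ℂ

/-- The derivation of `𝒜` that sends `m_j(δ_i)^(α)` to `m_j(δ_i)^(α + 1)`. -/
noncomputable def freeDeriv (m : ℕ) : Derivation ℂ (FreeDiffAlg m) (FreeDiffAlg m) :=
  MvPolynomial.mkDerivation ℂ fun v => MvPolynomial.X (v.1, v.2.1, v.2.2 + 1)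

noncomputable instance (m : ℕ) : Differential (FreeDiffAlg m) where
  deriv := (freeDeriv m).restrictScalars ℤ

/-- The subalgebra `𝒜_r` of `𝒜` generated by the derivatives of the `m_j(δ_i)` with `j ≤ r`. -/
noncomputable def freeDiffSubalg (m r : ℕ) : Subalgebra ℂ (FreeDiffAlg m) :=
  MvPolynomial.supported ℂ {v | (v.2.1 : ℕ) ≤ r}

theorem deriv_mem_freeDiffSubalg {m r : ℕ} {x : FreeDiffAlg m} (hx : x ∈ freeDiffSubalg m r) :
    x′ ∈ freeDiffSubalg m r := by
  change freeDeriv m x ∈ freeDiffSubalg m r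
  rw [freeDiffSubalg, MvPolynomial.supported_eq_adjoin_X] at hx ⊢
  induction hx using Algebra.adjoin_induction with
  | mem x h =>
    obtain ⟨v, hv, rfl⟩ := h
    rw [freeDeriv, MvPolynomial.mkDerivation_X]
    exact Algebra.subset_adjoin ⟨(v.1, v.2.1, v.2.2 + 1), hv, rfl⟩
  | algebraMap c => rw [Derivation.map_algebraMap]; exact zero_mem _
  | add x y _ _ hx hy => rw [map_add]; exact add_mem hx hy
  | mul x y hx hy hx' hy' =>
    rw [Derivation.leibniz, smul_eq_mul, smul_eq_mul]
    exact add_mem (mul_mem hx hy') (mul_mem hy hx')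

/-- `𝒜_r` is a differential algebra, with the derivation of `𝒜`. -/
noncomputable instance (m r : ℕ) : Differential (freeDiffSubalg m r) where
  deriv := Derivation.mk'
    { toFun := fun x => ⟨(x : FreeDiffAlg m)′, deriv_mem_freeDiffSubalg x.2⟩
      map_add' := fun x y => Subtype.ext (by simp)
      map_smul' := fun c x => Subtype.ext (by simp) }
    fun x y => Subtype.ext (by simp)

/-! ## The universal holonomy -/

/-- The series `t + ∑_{j ≥ 1} ε ^ j m_j(δ_i)`. -/
noncomputable def universalSeries {m : ℕ} (i : Fin m) : FormalDiffeo (FreeDiffAlg m) where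
  toSeries := PowerSeries.mk fun j =>
    if h : 0 < j then MvPolynomial.X (i, ⟨j, h⟩, 0) else 0
  X_dvd := by simp [PowerSeries.X_dvd_iff]

/-- The universal holonomy of a group with free basis `δ_1, …, δ_m`: the homomorphism to the group
of formal series under composition with `δ_i ↦ t + ∑_{j ≥ 1} ε ^ j m_j(δ_i)`. -/
noncomputable def universalHolonomy {G : Type*} [Group G] {m : ℕ} (δ : FreeGroupBasis (Fin m) G) :
    G →* FormalDiffeo (FreeDiffAlg m) :=
  δ.lift universalSeries

/-- The component `m_j(g) ∈ 𝒜` of the universal holonomy `t + ∑_{j ≥ 1} ε ^ j m_j(g)` of `g`. -/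
noncomputable def universalMelnikov {G : Type*} [Group G] {m : ℕ} (δ : FreeGroupBasis (Fin m) G)
    (j : ℕ) (g : G) : FreeDiffAlg m :=
  PowerSeries.coeff j (universalHolonomy δ g).toSeries

/-- The lower central series, with the numbering `L_1 = G`, `L_{i + 1} = [L_i, G]`
(and `L_0 = G`). -/
def lowerCentral (G : Type*) [Group G] (i : ℕ) : Subgroup G :=
  (⊤ : Subgroup G).lowerCentralSeries (i - 1)

/-! ## The orbit of a loop under the monodromy of a polynomial -/

/-- The fibre `{H = t}` in `ℂ²`. -/
def fiber (H : MvPolynomial (Fin 2) ℂ) (t : ℂ) : Set (Fin 2 → ℂ) :=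
  {p | MvPolynomial.eval p H = t}

/-- `t` is typical for `H : ℂ² → ℂ` if it is not a critical value of `H` and `H` is a locally
trivial fibration over a neighbourhood of `t`. -/
def IsTypical (H : MvPolynomial (Fin 2) ℂ) (t : ℂ) : Prop :=
  (∀ p ∈ fiber H t, ∃ i, MvPolynomial.eval p (MvPolynomial.pderiv i H) ≠ 0) ∧
    ∃ e : Bundle.Trivialization (fiber H t) (fun p : Fin 2 → ℂ => MvPolynomial.eval p H), t ∈ e.baseSet

/-- The set `Σ_H` of atypical values of `H`. -/
def atypicalValues (H : MvPolynomial (Fin 2) ℂ) : Set ℂ :=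
  {t | ¬ IsTypical H t}

section Monodromy

variable {H : MvPolynomial (Fin 2) ℂ} {t₀ : ℂ} {p₀ : fiber H t₀}

/-- The monodromy along a loop `ρ` in `ℂ²` at `p₀`, a lift of the loop `H ∘ ρ` in `ℂ`, sends the
class `a` to the class `b` if a loop in `a` is carried to a loop in `b` by a continuous family of
loops `Γ(s, ·)` in the fibres `{H = H(ρ(s))}` with base points `ρ(s)`. -/
def MonodromySends (ρ : Path (p₀ : Fin 2 → ℂ) p₀) (a b : FundamentalGroup (fiber H t₀) p₀) :
    Prop :=
  ∃ (α β : Path p₀ p₀) (Γ : C(unitInterval × unitInterval, Fin 2 → ℂ)),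
    FundamentalGroup.fromPath (.mk α) = a ∧ FundamentalGroup.fromPath (.mk β) = b ∧
    (∀ s u, Γ (s, u) ∈ fiber H (MvPolynomial.eval (ρ s) H)) ∧
    (∀ s, Γ (s, 0) = ρ s ∧ Γ (s, 1) = ρ s) ∧
    (∀ u, Γ (0, u) = α u) ∧ (∀ u, Γ (1, u) = β u)

/-- The subgroup `𝒪` of `π₁({H = t₀}, p₀)` generated by the images of `γ` under the monodromy along
all the loops at `p₀` in `ℂ² ∖ H⁻¹(Σ_H)`. -/
noncomputable def orbitSubgroup (γ : Path p₀ p₀) : Subgroup (FundamentalGroup (fiber H t₀) p₀) :=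
  Subgroup.closure {b | ∃ ρ : Path (p₀ : Fin 2 → ℂ) p₀,
    (∀ s, MvPolynomial.eval (ρ s) H ∉ atypicalValues H) ∧
    MonodromySends ρ (FundamentalGroup.fromPath (.mk γ)) b}

end Monodromy

open scoped commutatorElement

/-! ## The Ritt–Raudenbush basis theorem -/

/-! The argument is algebraic and works for any subgroup `𝒪` of a free group of finite rank. If `F -
id` has order `l` in `ε`, its commutator with any series has order at least `l + 1`, and the number
of orders, counted from the leading one, at which coefficients are known to lie in `𝒜_k` does not
shrink (`FormalDiffeo.coeffsIn_commutator`). Hence for `g ∈ L_l` the `m_j(g)` vanish for `j < l` and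
lie in `𝒜_k` for `j ≤ l + k - 1` (`universalHolonomy_mem_filtration`).

So all the elements in question live in one differential algebra with finitely many differential
generators. By the Ritt–Raudenbush theorem (`isRittNoetherian_freeDiffSubalg`), the radical
differential ideals generated by the `m_j(g)` with `g ∈ 𝒪 ∩ L_q`, `q ≤ n`, stabilise in `n`
(`exists_melnikovSet_subset`). Replacing all `g` by the chosen `σ` costs an increase of `n` to `n +
k` (`melnikovSet_subset_differentialIdeal`): series with low coefficients in a differential ideal
form a group, so one can descend in `q` modulo `𝒪 ∩ L_{q+1}`, starting where the relevant
coefficients vanish. A change of free basis induces a differential homomorphism carrying each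
`m_j(g)` to `m_j(g)`, so `n` does not depend on the basis.

For Ritt–Raudenbush, a maximal radical differential ideal `P` that is not finitely generated is
prime. When one differential generator `x` is adjoined, choose `f ∈ P` of least order and degree in
`x` outside the ideal generated by the contraction of `P`. Its initial and separant are not in `P`,
yet reduction by `f` shows that their product multiplies `P` into a finitely generated radical
differential ideal inside `P`, which is impossible. -/

theorem Ideal.mem_of_natCast_mul_mem {R : Type*} [CommRing R] [Algebra ℚ R] {I : Ideal R}
    {n : ℕ} (hn : n ≠ 0) {x : R}
    (h : (n : R) * x ∈ I) : x ∈ I := by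
  have h1 := I.mul_mem_left (algebraMap ℚ R (n : ℚ)⁻¹) h
  rwa [← mul_assoc, ← map_natCast (algebraMap ℚ R), ← map_mul,
    inv_mul_cancel₀ (Nat.cast_ne_zero.2 hn), map_one, one_mul] at h1

/-! ### Calculus of radical differential ideals and finite generation. -/

section RadicalDifferentialIdeal

variable {R : Type*} [CommRing R] [Differential R]

/-- A radical differential ideal: a radical ideal that is closed under the derivation. -/
structure IsRadicalDifferential (I : Ideal R) : Prop where
  isRadical : I.IsRadical
  deriv_mem : ∀ x ∈ I, x′ ∈ I

/-- The radical of the differential ideal generated by a set. -/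
def radicalDifferentialIdeal (S : Set R) : Ideal R :=
  (differentialIdeal S).radical

/-- Every radical differential ideal is the radical of a finitely generated differential ideal. -/
def IsRittNoetherian (R : Type*) [CommRing R] [Differential R] : Prop :=
  ∀ I : Ideal R, IsRadicalDifferential I →
    ∃ F : Finset R, I = radicalDifferentialIdeal (F : Set R)

namespace IsRadicalDifferential

variable {I : Ideal R}

theorem mem_of_pow_mem (hI : IsRadicalDifferential I) {x : R} {n : ℕ} (h : x ^ n ∈ I) : x ∈ I :=
  hI.isRadical ⟨n, h⟩

theorem mem_of_mul_self_mem (hI : IsRadicalDifferential I) {x : R} (h : x * x ∈ I) : x ∈ I :=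
  hI.mem_of_pow_mem (n := 2) (by rwa [pow_two])

/-- Since `(a b′)² = a b′ (a b)′ - a′ b′ (a b)`, the square lies in `I`. -/
theorem mul_deriv_mem (hI : IsRadicalDifferential I) {a b : R} (h : a * b ∈ I) :
    a * b′ ∈ I := by
  refine hI.mem_of_mul_self_mem ?_
  have h1 := I.mul_mem_left (a * b′) (hI.deriv_mem _ h)
  have h2 := I.mul_mem_left (a′ * b′) h
  rw [Derivation.leibniz, smul_eq_mul, smul_eq_mul] at h1
  convert sub_mem h1 h2 using 1
  ring

/-- The ideal is the colon ideal `(I : a)`. It lets a statement about products be checked on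
generators, one factor at a time. -/
theorem comap_mulLeft (hI : IsRadicalDifferential I) (a : R) :
    IsRadicalDifferential (Submodule.comap (LinearMap.mulLeft R a) I : Ideal R) where
  isRadical := by
    rintro y ⟨n, hy⟩
    simp only [Submodule.mem_comap, LinearMap.mulLeft_apply] at hy ⊢
    refine hI.mem_of_pow_mem (n := n + 1) ?_
    convert I.mul_mem_left (a ^ n * y) hy using 1
    ring
  deriv_mem y hy := hI.mul_deriv_mem hy

theorem comap {A : Type*} [CommRing A] [Differential A] (hI : IsRadicalDifferential I)
    (φ : A →+* R) (hφ : ∀ a, φ (a′) = (φ a)′) : IsRadicalDifferential (I.comap φ) where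
  isRadical := hI.isRadical.comap φ
  deriv_mem x hx := by
    rw [Ideal.mem_comap, hφ]
    exact hI.deriv_mem _ hx

theorem radicalDifferentialIdeal_le (hI : IsRadicalDifferential I) {S : Set R} (h : S ⊆ I) :
    radicalDifferentialIdeal S ≤ I :=
  hI.isRadical.radical_le_iff.2 (differentialIdeal_le h hI.deriv_mem)

/-- Two colon ideals do it: each `(I : s)` contains `T`, hence `y`; then `(I : y)` contains `S`,
hence `x`. -/
theorem mul_mem_of_mem_radicalDifferentialIdeal (hI : IsRadicalDifferential I) {S T : Set R}
    (h : ∀ s ∈ S, ∀ t ∈ T, s * t ∈ I) {x y : R} (hx : x ∈ radicalDifferentialIdeal S)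
    (hy : y ∈ radicalDifferentialIdeal T) : x * y ∈ I := by
  have h1 : ∀ s ∈ S, s * y ∈ I := fun s hs =>
    (hI.comap_mulLeft s).radicalDifferentialIdeal_le (fun t ht => h s hs t ht) hy
  have h2 := (hI.comap_mulLeft y).radicalDifferentialIdeal_le (S := S) (fun s hs => by
    simpa [mul_comm] using h1 s hs) hx
  simpa [mul_comm] using h2

end IsRadicalDifferential

theorem differentialIdeal_le_radicalDifferentialIdeal (S : Set R) :
    differentialIdeal S ≤ radicalDifferentialIdeal S :=
  Ideal.le_radical

theorem subset_radicalDifferentialIdeal (S : Set R) :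
    S ⊆ radicalDifferentialIdeal S :=
  fun _ hs => Ideal.le_radical (subset_differentialIdeal S hs)

theorem differentialIdeal_mono {S T : Set R} (h : S ⊆ T) :
    differentialIdeal S ≤ differentialIdeal T :=
  differentialIdeal_le (h.trans (subset_differentialIdeal T))
    fun _ => deriv_mem_differentialIdeal

theorem radicalDifferentialIdeal_mono {S T : Set R} (h : S ⊆ T) :
    radicalDifferentialIdeal S ≤ radicalDifferentialIdeal T :=
  Ideal.radical_mono (differentialIdeal_mono h)

theorem exists_finset_mem_radicalDifferentialIdeal {S : Set R} {x : R}
    (hx : x ∈ radicalDifferentialIdeal S) :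
    ∃ F : Finset R, (F : Set R) ⊆ S ∧ x ∈ radicalDifferentialIdeal (F : Set R) := by
  classical
  obtain ⟨n, hn⟩ := hx
  suffices ∀ y ∈ differentialIdeal S,
      ∃ F : Finset R, (F : Set R) ⊆ S ∧ y ∈ differentialIdeal (F : Set R) by
    obtain ⟨F, hF, h⟩ := this _ hn
    exact ⟨F, hF, n, h⟩
  intro y hy
  induction hy using Submodule.span_induction with
  | mem y h =>
    obtain ⟨s, hs, α, rfl⟩ := h
    exact ⟨{s}, by simpa using hs, Ideal.subset_span ⟨s, by simp, α, rfl⟩⟩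
  | zero => exact ⟨∅, by simp, zero_mem _⟩
  | add y z _ _ hy hz =>
    obtain ⟨F, hF, h⟩ := hy
    obtain ⟨G, hG, h'⟩ := hz
    refine ⟨F ∪ G, by simp [hF, hG], add_mem (differentialIdeal_mono ?_ h)
      (differentialIdeal_mono ?_ h')⟩ <;> simp
  | smul a y _ hy =>
    obtain ⟨F, hF, h⟩ := hy
    exact ⟨F, hF, Ideal.mul_mem_left _ _ h⟩

theorem exists_finset_subset_radicalDifferentialIdeal {S : Set R} (G : Finset R)
    (hG : (G : Set R) ⊆ radicalDifferentialIdeal S) :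
    ∃ F : Finset R, (F : Set R) ⊆ S ∧ (G : Set R) ⊆ radicalDifferentialIdeal (F : Set R) := by
  classical
  induction G using Finset.induction_on with
  | empty => exact ⟨∅, by simp, by simp⟩
  | insert a G _ ih =>
    rw [Finset.coe_insert, Set.insert_subset_iff] at hG
    obtain ⟨F, hF, h⟩ := ih hG.2
    obtain ⟨F', hF', h'⟩ := exists_finset_mem_radicalDifferentialIdeal hG.1
    refine ⟨F ∪ F', by simp [hF, hF'], ?_⟩
    rw [Finset.coe_insert, Set.insert_subset_iff]
    exact ⟨radicalDifferentialIdeal_mono (by simp) h',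
      h.trans (radicalDifferentialIdeal_mono (by simp))⟩

/-- Base case of the induction on the number of differential generators, applied to the constants
`ℂ`. -/
theorem isRittNoetherian_of_isNoetherianRing [IsNoetherianRing R] : IsRittNoetherian R := by
  intro I hI
  obtain ⟨F, rfl⟩ := (isNoetherianRing_iff_ideal_fg R).1 ‹_› I
  exact ⟨F, le_antisymm (Ideal.span_le.2 (subset_radicalDifferentialIdeal _))
    (hI.radicalDifferentialIdeal_le Ideal.subset_span)⟩

/-- The extra factor `y` avoids the exponent `n - 1`, so `n = 0` needs no separate form. -/
theorem mul_deriv_pow (y : R) (n : ℕ) : y * (y ^ n)′ = n * y ^ n * y′ := by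
  rw [Derivation.leibniz_pow]
  cases n with
  | zero => simp
  | succ n => simp; ring

/-- A maximal element among the radical differential ideals that are not finitely generated. -/
structure IsMaximalNonFG (P : Ideal R) : Prop where
  isRadicalDifferential : IsRadicalDifferential P
  not_fg : ¬ ∃ F : Finset R, P = radicalDifferentialIdeal (F : Set R)
  fg_of_lt : ∀ J : Ideal R, IsRadicalDifferential J → P < J →
    ∃ F : Finset R, J = radicalDifferentialIdeal (F : Set R)

theorem IsMaximalNonFG.false_of_le {P : Ideal R} (hP : IsMaximalNonFG P) {F : Finset R}
    (hF : (F : Set R) ⊆ P)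
    (h : P ≤ radicalDifferentialIdeal (F : Set R)) : False :=
  hP.not_fg ⟨F, le_antisymm h (hP.isRadicalDifferential.radicalDifferentialIdeal_le hF)⟩

theorem exists_isMaximalNonFG (h : ¬ IsRittNoetherian R) : ∃ P : Ideal R, IsMaximalNonFG P := by
  simp only [IsRittNoetherian, not_forall] at h
  obtain ⟨I, hI, hI'⟩ := h
  have hchains : ∀ c ⊆ {J : Ideal R | IsRadicalDifferential J ∧
      ¬ ∃ F : Finset R, J = radicalDifferentialIdeal (F : Set R)}, IsChain (· ≤ ·) c →
      ∀ y ∈ c, ∃ ub ∈ {J : Ideal R | IsRadicalDifferential J ∧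
        ¬ ∃ F : Finset R, J = radicalDifferentialIdeal (F : Set R)}, ∀ z ∈ c, z ≤ ub := by
    intro c hc hchain y hy
    have hmem : ∀ x, x ∈ sSup c ↔ ∃ J ∈ c, x ∈ J := fun x =>
      Submodule.mem_sSup_of_directed ⟨y, hy⟩ hchain.directedOn
    have hrad : IsRadicalDifferential (sSup c) := by
      refine ⟨?_, fun x hx => ?_⟩
      · rintro x ⟨n, hx⟩
        obtain ⟨J, hJ, h⟩ := (hmem _).1 hx
        exact (hmem _).2 ⟨J, hJ, (hc hJ).1.mem_of_pow_mem h⟩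
      · obtain ⟨J, hJ, h⟩ := (hmem _).1 hx
        exact (hmem _).2 ⟨J, hJ, (hc hJ).1.deriv_mem _ h⟩
    refine ⟨sSup c, ⟨hrad, ?_⟩, fun z hz => le_sSup hz⟩
    rintro ⟨F, hF⟩
    -- A finite subset of the union of a chain lies in one member, so finite generation of the union
    -- would pass to that member.
    have h1 : ∀ G : Finset R, (G : Set R) ⊆ (sSup c : Ideal R) →
        ∃ J ∈ c, (G : Set R) ⊆ (J : Ideal R) := by
      classical
      intro G hG
      induction G using Finset.induction_on with
      | empty => exact ⟨y, hy, by simp⟩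
      | insert a G _ ih =>
        rw [Finset.coe_insert, Set.insert_subset_iff] at hG
        obtain ⟨J, hJ, h⟩ := ih hG.2
        obtain ⟨K, hK, h'⟩ := (hmem _).1 hG.1
        simp only [Finset.coe_insert, Set.insert_subset_iff]
        obtain hle | hle := hchain.total hJ hK
        · exact ⟨K, hK, h', h.trans hle⟩
        · exact ⟨J, hJ, hle h', h⟩
    obtain ⟨J, hJ, h⟩ := h1 F (hF ▸ subset_radicalDifferentialIdeal _)
    refine (hc hJ).2 ⟨F, le_antisymm ?_ ((hc hJ).1.radicalDifferentialIdeal_le h)⟩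
    rw [← hF]
    exact le_sSup hJ
  obtain ⟨P, -, hP⟩ := zorn_le_nonempty₀ _ hchains I ⟨hI, hI'⟩
  refine ⟨P, hP.prop.1, hP.prop.2, fun J hJ hlt => ?_⟩
  by_contra hJ'
  exact hlt.not_ge (hP.le_of_ge ⟨hJ, hJ'⟩ hlt.le)

/-! ### Maximal non-finitely-generated ideals over `ℚ`-algebras. -/

section RittAlgebra

variable [Algebra ℚ R]

/-- Characteristic zero is essential here: differentiating a power brings out an integer factor that
must be cancelled. -/
theorem isRadicalDifferential_radical {I : Ideal R} (hI : ∀ x ∈ I, x′ ∈ I) :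
    IsRadicalDifferential I.radical where
  isRadical := Ideal.radical_isRadical I
  deriv_mem x hx := by
    obtain ⟨n, hn⟩ := hx
    -- Each step trades one factor `x` for two factors `x′`. Multiplying the derivative of `x ^ (m +
    -- 1) * x′ ^ (2 * k)` by `x′` gives `(m + 1) x ^ m x′ ^ (2 * k + 2)` plus a multiple of the
    -- original element.
    suffices ∀ k m, k + m = n → x ^ m * x′ ^ (2 * k) ∈ I from
      ⟨2 * n, by simpa using this n 0 rfl⟩
    intro k
    induction k with
    | zero => intro m hm; simpa [← hm] using hn
    | succ k ih =>
      intro m hm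
      have h0 := ih (m + 1) (by omega)
      have h1 := I.mul_mem_left (x′) (hI _ h0)
      have h2 := I.mul_mem_left (((2 * k : ℕ) : R) * x′′) h0
      refine Ideal.mem_of_natCast_mul_mem (n := m + 1) (by omega) ?_
      convert sub_mem h1 h2 using 1
      have h3 := mul_deriv_pow (x′) (2 * k)
      have h4 : (x ^ (m + 1))′ = (m + 1 : ℕ) * x ^ m * x′ := by
        rw [Derivation.leibniz_pow]; simp [mul_assoc]
      rw [Derivation.leibniz, smul_eq_mul, smul_eq_mul, h4]
      linear_combination (-x ^ (m + 1)) * h3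

theorem isRadicalDifferential_radicalDifferentialIdeal (S : Set R) :
    IsRadicalDifferential (radicalDifferentialIdeal S) :=
  isRadicalDifferential_radical fun _ => deriv_mem_differentialIdeal

namespace IsMaximalNonFG

variable {P : Ideal R}

/-- By maximality, `P` and `a` together generate a finitely generated radical differential ideal;
finitely many elements of `P ∪ {a}` suffice to generate it. -/
theorem exists_finset_of_notMem (hP : IsMaximalNonFG P) {a : R} (ha : a ∉ P) :
    ∃ G : Finset R, (G : Set R) ⊆ P ∧
      P ≤ radicalDifferentialIdeal (insert a (G : Set R)) := by
  classical
  have hlt : P < radicalDifferentialIdeal (insert a (P : Set R)) := by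
    refine lt_of_le_of_ne (fun x hx => subset_radicalDifferentialIdeal _ (Or.inr hx)) fun h => ?_
    rw [h] at ha
    exact ha (subset_radicalDifferentialIdeal _ (Or.inl rfl))
  obtain ⟨F, hF⟩ := hP.fg_of_lt _ (isRadicalDifferential_radicalDifferentialIdeal _) hlt
  obtain ⟨G, hG, h⟩ := exists_finset_subset_radicalDifferentialIdeal F
    (S := insert a (P : Set R)) (hF ▸ subset_radicalDifferentialIdeal (F : Set R))
  refine ⟨G.erase a, fun x hx => ?_, hlt.le.trans ?_⟩
  · rw [Finset.mem_coe, Finset.mem_erase] at hx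
    exact (hG hx.2).resolve_left hx.1
  · rw [hF]
    refine (isRadicalDifferential_radicalDifferentialIdeal _).radicalDifferentialIdeal_le
      (h.trans (radicalDifferentialIdeal_mono fun x hx => ?_))
    by_cases hxa : x = a
    · exact Or.inl hxa
    · exact Or.inr (Finset.mem_erase.2 ⟨hxa, hx⟩)

/-- Primality of `P`. If neither factor were in `P`, then `P` would lie in the ideals generated by
`a, F` and by `b, G`; multiplying, `x²` for `x ∈ P` lies in the one generated by `a * b, F, G`, so
`P` would be finitely generated. -/
theorem mem_or_mem (hP : IsMaximalNonFG P) {a b : R} (hab : a * b ∈ P) : a ∈ P ∨ b ∈ P := by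
  classical
  by_contra! h
  obtain ⟨F, hF, hF'⟩ := hP.exists_finset_of_notMem h.1
  obtain ⟨G, hG, hG'⟩ := hP.exists_finset_of_notMem h.2
  refine hP.false_of_le (F := insert (a * b) (F ∪ G)) ?_ fun x hx => ?_
  · simp [Set.insert_subset_iff, hF, hG, hab]
  have hrad := isRadicalDifferential_radicalDifferentialIdeal
    ((insert (a * b) (F ∪ G) : Finset R) : Set R)
  have hsub := subset_radicalDifferentialIdeal ((insert (a * b) (F ∪ G) : Finset R) : Set R)
  refine hrad.mem_of_mul_self_mem
    (hrad.mul_mem_of_mem_radicalDifferentialIdeal ?_ (hF' hx) (hG' hx))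
  rintro s (rfl | hs) t (rfl | ht)
  · exact hsub (by simp)
  · exact Ideal.mul_mem_left _ _ (hsub (by simpa using Or.inr (Or.inr ht)))
  · exact Ideal.mul_mem_right _ _ (hsub (by simpa using Or.inr (Or.inl hs)))
  · exact Ideal.mul_mem_right _ _ (hsub (by simpa using Or.inr (Or.inl hs)))

/-- This is how the contradiction is reached: `P` lies in the ideal generated by `h` and some finite
`G ⊆ P`. Multiplying that ideal by `x ∈ P` lands in the one generated by `F ∪ G`, which therefore
contains `x²`. -/
theorem false_of_mul_mem (hP : IsMaximalNonFG P) {h : R} (hh : h ∉ P) {F : Finset R}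
    (hF : (F : Set R) ⊆ P) (hmul : ∀ g ∈ P, h * g ∈ radicalDifferentialIdeal (F : Set R)) :
    False := by
  classical
  obtain ⟨G, hG, hG'⟩ := hP.exists_finset_of_notMem hh
  refine hP.false_of_le (F := F ∪ G) (by simp [hF, hG]) fun x hx => ?_
  have hrad := isRadicalDifferential_radicalDifferentialIdeal ((F ∪ G : Finset R) : Set R)
  refine hrad.mem_of_mul_self_mem (hrad.mul_mem_of_mem_radicalDifferentialIdeal (T := {x}) ?_
    (hG' hx) (subset_radicalDifferentialIdeal _ rfl))
  rintro s (rfl | hs) t rfl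
  · exact radicalDifferentialIdeal_mono (by simp) (hmul _ hx)
  · exact Ideal.mul_mem_right _ _ (subset_radicalDifferentialIdeal _ (by simpa using Or.inr hs))

end IsMaximalNonFG

end RittAlgebra

end RadicalDifferentialIdeal
-- Adjoining one differential generator: reduction by initial and separant.
section DifferentialExtension

open Polynomial

variable {A B : Type*} [CommRing A] [CommRing B] [Differential B]

/-- The subring generated by the image of `φ : A →+* B` and the first `n` of the elements
`x, x′, x′′, …`. -/
def derivSubring (φ : A →+* B) (x : B) (n : ℕ) : Subring B :=
  Subring.closure (Set.range φ ∪ {b | ∃ i < n, b = (fun y : B => y′)^[i] x})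

/-- Evaluation of a polynomial with coefficients in `derivSubring φ x n` at the `n`-th derivative
of `x`. -/
noncomputable def derivEval (φ : A →+* B) (x : B) (n : ℕ) : (derivSubring φ x n)[X] →+* B :=
  eval₂RingHom (derivSubring φ x n).subtype ((fun y : B => y′)^[n] x)

variable {φ : A →+* B} {x : B} {n : ℕ}

theorem map_mem_derivSubring (a : A) : φ a ∈ derivSubring φ x n :=
  Subring.subset_closure (Or.inl ⟨a, rfl⟩)

theorem iterate_deriv_mem_derivSubring {i : ℕ} (hi : i < n) :
    (fun y : B => y′)^[i] x ∈ derivSubring φ x n :=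
  Subring.subset_closure (Or.inr ⟨i, hi, rfl⟩)

theorem derivSubring_mono : Monotone (derivSubring φ x) := by
  intro m n h
  refine Subring.closure_mono (Set.union_subset_union_right _ ?_)
  rintro _ ⟨i, hi, rfl⟩
  exact ⟨i, hi.trans_le h, rfl⟩

theorem exists_map_eq_of_mem_derivSubring_zero {b : B} (hb : b ∈ derivSubring φ x 0) :
    ∃ a, φ a = b := by
  have : derivSubring φ x 0 ≤ φ.range := by
    refine Subring.closure_le.2 ?_
    rintro _ (⟨a, rfl⟩ | ⟨i, hi, rfl⟩)
    · exact ⟨a, rfl⟩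
    · omega
  exact this hb

theorem deriv_mem_derivSubring [Differential A] (hφ : ∀ a, φ (a′) = (φ a)′) {b : B}
    (hb : b ∈ derivSubring φ x n) : b′ ∈ derivSubring φ x (n + 1) := by
  have hle := derivSubring_mono (φ := φ) (x := x) n.le_succ
  induction hb using Subring.closure_induction with
  | mem b h =>
    obtain ⟨a, rfl⟩ | ⟨i, hi, rfl⟩ := h
    · rw [← hφ]; exact map_mem_derivSubring _
    · rw [← Function.iterate_succ_apply' (fun y : B => y′)]
      exact iterate_deriv_mem_derivSubring (by omega)
  | zero => rw [map_zero]; exact zero_mem _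
  | one => rw [Derivation.map_one_eq_zero]; exact zero_mem _
  | add a b _ _ ha hb => rw [map_add]; exact add_mem ha hb
  | neg a _ ha => rw [map_neg]; exact neg_mem ha
  | mul a b ha' hb' ha hb =>
    rw [Derivation.leibniz, smul_eq_mul, smul_eq_mul]
    exact add_mem (mul_mem (hle ha') hb) (mul_mem (hle hb') ha)

theorem derivEval_C (c : derivSubring φ x n) : derivEval φ x n (C c) = c := by
  simp [derivEval]

theorem derivEval_X : derivEval φ x n X = (fun y : B => y′)^[n] x := by
  simp [derivEval]

theorem derivEval_mem (p : (derivSubring φ x n)[X]) :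
    derivEval φ x n p ∈ derivSubring φ x (n + 1) := by
  induction p using Polynomial.induction_on' with
  | add p q hp hq => rw [map_add]; exact add_mem hp hq
  | monomial k c =>
    rw [← C_mul_X_pow_eq_monomial, map_mul, map_pow, derivEval_C, derivEval_X]
    exact mul_mem (derivSubring_mono n.le_succ c.2)
      (pow_mem (iterate_deriv_mem_derivSubring n.lt_succ_self) k)

theorem exists_derivEval_eq {b : B} (hb : b ∈ derivSubring φ x (n + 1)) :
    ∃ p, derivEval φ x n p = b := by
  have : derivSubring φ x (n + 1) ≤ (derivEval φ x n).range := by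
    refine Subring.closure_le.2 ?_
    rintro _ (⟨a, rfl⟩ | ⟨i, hi, rfl⟩)
    · exact ⟨C ⟨φ a, map_mem_derivSubring a⟩, derivEval_C _⟩
    · obtain h | rfl := Nat.lt_succ_iff_lt_or_eq.1 hi
      · exact ⟨C ⟨_, iterate_deriv_mem_derivSubring h⟩, derivEval_C _⟩
      · exact ⟨X, derivEval_X⟩
  exact this hb

theorem exists_deriv_derivEval [Differential A] (hφ : ∀ a, φ (a′) = (φ a)′)
    (p : (derivSubring φ x n)[X]) : ∃ T ∈ derivSubring φ x (n + 1),
      (derivEval φ x n p)′ =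
        derivEval φ x n (derivative p) * (fun y : B => y′)^[n + 1] x + T := by
  induction p using Polynomial.induction_on' with
  | add p q hp hq =>
    obtain ⟨T, hT, h⟩ := hp
    obtain ⟨U, hU, h'⟩ := hq
    refine ⟨T + U, add_mem hT hU, ?_⟩
    rw [map_add, map_add, map_add, map_add, h, h']
    ring
  | monomial k c =>
    refine ⟨(c : B)′ * ((fun y : B => y′)^[n] x) ^ k,
      mul_mem (deriv_mem_derivSubring hφ c.2)
        (pow_mem (iterate_deriv_mem_derivSubring n.lt_succ_self) k), ?_⟩
    rw [← C_mul_X_pow_eq_monomial, derivative_C_mul_X_pow]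
    simp only [map_mul, map_pow, derivEval_C, derivEval_X, map_natCast, Derivation.leibniz,
      Derivation.leibniz_pow, smul_eq_mul, nsmul_eq_mul, Function.iterate_succ_apply']
    ring

/-- Every proper derivative of `f = p(x^(n))` is linear in its highest derivative of `x`, always
with the same coefficient, the separant. Hence powers of one element suffice for the reduction. -/
theorem exists_iterate_deriv_derivEval [Differential A] (hφ : ∀ a, φ (a′) = (φ a)′)
    (p : (derivSubring φ x n)[X]) (j : ℕ) : ∃ T ∈ derivSubring φ x (n + j + 1),
      (fun y : B => y′)^[j + 1] (derivEval φ x n p) =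
        derivEval φ x n (derivative p) * (fun y : B => y′)^[n + j + 1] x + T := by
  induction j with
  | zero => exact exists_deriv_derivEval hφ p
  | succ j ih =>
    obtain ⟨T, hT, h⟩ := ih
    refine ⟨(fun y : B => y′)^[n + j + 1] x * (derivEval φ x n (derivative p))′ + T′,
      add_mem (mul_mem (iterate_deriv_mem_derivSubring (by omega)) ?_)
        (deriv_mem_derivSubring hφ hT), ?_⟩
    · exact derivSubring_mono (show n + 1 + 1 ≤ n + j + 1 + 1 by omega)
        (deriv_mem_derivSubring hφ (derivEval_mem _))
    · rw [Function.iterate_succ_apply', h, map_add, Derivation.leibniz, smul_eq_mul, smul_eq_mul,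
        ← Function.iterate_succ_apply' (fun y : B => y′),
        show n + (j + 1) + 1 = (n + j + 1).succ by omega]
      ring

/-- Reduction by the derivatives of `f = p(x^(n))`: modulo these, every element becomes a
polynomial in `x^(n)` after multiplication by a power of the separant `p'(x^(n))`. -/
theorem exists_separant_pow_mul_sub_mem [Differential A] (hφ : ∀ a, φ (a′) = (φ a)′)
    (p : (derivSubring φ x n)[X]) (N : ℕ) {g : B} (hg : g ∈ derivSubring φ x N) :
    ∃ (e : ℕ), ∃ r ∈ derivSubring φ x (n + 1),
      derivEval φ x n (derivative p) ^ e * g - r ∈ differentialIdeal {derivEval φ x n p} := by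
  set S := derivEval φ x n (derivative p) with hS
  set J := differentialIdeal {derivEval φ x n p} with hJ
  have hSmem : S ∈ derivSubring φ x (n + 1) := derivEval_mem _
  -- The reducible elements form a subring, so only the generators `x^(i)` need to be reduced.
  let M : Subring B :=
    { carrier := {g | ∃ (e : ℕ), ∃ r ∈ derivSubring φ x (n + 1), S ^ e * g - r ∈ J}
      mul_mem' := by
        rintro a b ⟨e, r, hr, h⟩ ⟨e', r', hr', h'⟩
        refine ⟨e + e', r * r', mul_mem hr hr', ?_⟩
        convert add_mem (J.mul_mem_left (S ^ e' * b) h) (J.mul_mem_left r h') using 1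
        ring
      one_mem' := ⟨0, 1, one_mem _, by simp⟩
      add_mem' := by
        rintro a b ⟨e, r, hr, h⟩ ⟨e', r', hr', h'⟩
        refine ⟨e + e', S ^ e' * r + S ^ e * r',
          add_mem (mul_mem (pow_mem hSmem _) hr) (mul_mem (pow_mem hSmem _) hr'), ?_⟩
        convert add_mem (J.mul_mem_left (S ^ e') h) (J.mul_mem_left (S ^ e) h') using 1
        ring
      zero_mem' := ⟨0, 0, zero_mem _, by simp⟩
      neg_mem' := by
        rintro a ⟨e, r, hr, h⟩
        refine ⟨e, -r, neg_mem hr, ?_⟩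
        convert neg_mem h using 1
        ring }
  have hM : ∀ g ∈ derivSubring φ x (n + 1), g ∈ M := fun g hg => ⟨0, g, hg, by simp⟩
  have key : ∀ j, derivSubring φ x (n + j + 1) ≤ M := by
    intro j
    induction j with
    | zero => exact hM
    | succ j ih =>
      refine Subring.closure_le.2 ?_
      rintro _ (⟨a, rfl⟩ | ⟨i, hi, rfl⟩)
      · exact hM _ (map_mem_derivSubring a)
      · obtain h | rfl := Nat.lt_succ_iff_lt_or_eq.1 hi
        · exact ih (iterate_deriv_mem_derivSubring h)
        · obtain ⟨T, hT, h⟩ := exists_iterate_deriv_derivEval hφ p j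
          obtain ⟨e, r, hr, h'⟩ := ih hT
          refine ⟨e + 1, -r, neg_mem hr, ?_⟩
          -- Modulo `J`, `S * x^(n+j+1)` equals `-T`, and `T` has lower order, hence is already
          -- reducible.
          have h1 : (fun y : B => y′)^[j + 1] (derivEval φ x n p) ∈ J :=
            Ideal.subset_span ⟨_, rfl, _, rfl⟩
          rw [h] at h1
          convert sub_mem (J.mul_mem_left (S ^ e) h1) h' using 1
          rw [← hS, add_assoc n j 1]
          ring
  exact key N (derivSubring_mono (by omega) hg)

/-- Pseudo-division by a polynomial of positive degree. -/
theorem exists_leadingCoeff_pow_mul_sub_dvd {R : Type*} [CommRing R] {p : R[X]}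
    (hp : 0 < p.natDegree) (q : R[X]) :
    ∃ (e : ℕ) (r : R[X]), r.natDegree < p.natDegree ∧ p ∣ C p.leadingCoeff ^ e * q - r := by
  induction hd : q.natDegree using Nat.strong_induction_on generalizing q with
  | _ D ih =>
    obtain h | h := lt_or_ge D p.natDegree
    · exact ⟨0, q, hd ▸ h, by simp⟩
    · set q' := C p.leadingCoeff * q - C q.leadingCoeff * X ^ (D - p.natDegree) * p with hq'
      have hle : q'.natDegree ≤ D := by
        refine (natDegree_sub_le _ _).trans (max_le ?_ ?_)
        · exact (natDegree_C_mul_le _ _).trans hd.le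
        · refine natDegree_mul_le.trans ?_
          have := natDegree_C_mul_X_pow_le q.leadingCoeff (D - p.natDegree)
          omega
      have hcoeff : q'.coeff D = 0 := by
        rw [hq', coeff_sub, coeff_C_mul, mul_assoc, coeff_C_mul]
        have : (X ^ (D - p.natDegree) * p).coeff D = p.leadingCoeff := by
          rw [coeff_X_pow_mul', if_pos (Nat.sub_le _ _), Nat.sub_sub_self h, coeff_natDegree]
        rw [this, ← hd, coeff_natDegree]
        ring
      have hlt : q'.natDegree < D := by
        refine lt_of_le_of_ne hle fun heq => ?_
        have : q' = 0 := by rw [← leadingCoeff_eq_zero, leadingCoeff, heq, hcoeff]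
        rw [this, natDegree_zero] at heq
        omega
      obtain ⟨e, r, hr, hdvd⟩ := ih _ hlt q' rfl
      refine ⟨e + 1, r, hr, ?_⟩
      convert dvd_add hdvd (Dvd.intro_left
        (C p.leadingCoeff ^ e * (C q.leadingCoeff * X ^ (D - p.natDegree))) rfl) using 1
      rw [hq']
      ring

/-- A ring that is generated over a Ritt–Noetherian ring by the derivatives of one element is
Ritt–Noetherian. -/
theorem IsRittNoetherian.of_closure_eq_top [Differential A] [Algebra ℚ B]
    (hA : IsRittNoetherian A) (hφ : ∀ a, φ (a′) = (φ a)′)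
    (htop : ∀ b : B, ∃ N, b ∈ derivSubring φ x N) : IsRittNoetherian B := by
  classical
  by_contra hB
  obtain ⟨P, hP⟩ := exists_isMaximalNonFG hB
  have hPrad := hP.isRadicalDifferential
  obtain ⟨F, hF⟩ := hA _ (hPrad.comap φ hφ)
  have hFP : ((F.image φ : Finset B) : Set B) ⊆ P := by
    intro b hb
    obtain ⟨a, ha, rfl⟩ := Finset.mem_image.1 (Finset.mem_coe.1 hb)
    have := subset_radicalDifferentialIdeal _ (Finset.mem_coe.2 ha)
    rw [← hF] at this
    exact this
  -- `Q` is the part of `P` generated by its contraction to `A`. It is finitely generated, so `P`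
  -- must contain elements outside it.
  set Q := radicalDifferentialIdeal ((F.image φ : Finset B) : Set B) with hQ
  have hQrad : IsRadicalDifferential Q := isRadicalDifferential_radicalDifferentialIdeal _
  have hPQ0 : ∀ a, φ a ∈ P → φ a ∈ Q := by
    intro a ha
    rw [← Ideal.mem_comap, hF] at ha
    refine (hQrad.comap φ hφ).radicalDifferentialIdeal_le (fun b hb => ?_) ha
    exact subset_radicalDifferentialIdeal _ (Finset.mem_image_of_mem φ hb)
  have hex : ∃ N, ∃ f ∈ derivSubring φ x N, f ∈ P ∧ f ∉ Q := by
    by_contra! h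
    refine hP.false_of_le hFP fun f hf => ?_
    obtain ⟨N, hN⟩ := htop f
    exact h N f hN hf
  -- `n` is the least order in `x` of an element of `P` outside `Q`; next, `p` is chosen of least
  -- degree in `x^(n)`.
  obtain ⟨n, hn, hmin⟩ : ∃ n, (∃ f ∈ derivSubring φ x (n + 1), f ∈ P ∧ f ∉ Q) ∧
      ∀ f ∈ derivSubring φ x n, f ∈ P → f ∈ Q := by
    obtain ⟨f, hf, hfP, hfQ⟩ := Nat.find_spec hex
    have h0 : Nat.find hex ≠ 0 := by
      intro h0
      rw [h0] at hf
      obtain ⟨a, rfl⟩ := exists_map_eq_of_mem_derivSubring_zero hf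
      exact hfQ (hPQ0 a hfP)
    obtain ⟨n, hn⟩ := Nat.exists_eq_succ_of_ne_zero h0
    refine ⟨n, ⟨f, by rwa [hn] at hf, hfP, hfQ⟩, fun g hg hgP => ?_⟩
    by_contra hgQ
    exact Nat.find_min hex (by omega) ⟨g, hg, hgP, hgQ⟩
  set E := derivEval φ x n with hE
  obtain ⟨p, ⟨hpP, hpQ⟩, hpmin⟩ :=
    (measure (natDegree : (derivSubring φ x n)[X] → ℕ)).wf.has_min {p | E p ∈ P ∧ E p ∉ Q} (by
      obtain ⟨f, hf, h⟩ := hn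
      obtain ⟨p, rfl⟩ := exists_derivEval_eq hf
      exact ⟨p, h⟩)
  replace hpmin : ∀ q, q.natDegree < p.natDegree → E q ∈ P → E q ∈ Q := fun q hq hqP => by
    by_contra hqQ
    exact hpmin q ⟨hqP, hqQ⟩ hq
  have hpos : 0 < p.natDegree := by
    rw [Nat.pos_iff_ne_zero]
    intro h0
    rw [eq_C_of_natDegree_eq_zero h0, hE, derivEval_C] at hpP hpQ
    exact hpQ (hmin _ (Subtype.prop _) hpP)
  -- The initial has smaller order. Were it in `P`, it would be in `Q`, and so would `p` without its
  -- leading term, by minimality of the degree; then `E p ∈ Q`.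
  have hinit : (p.leadingCoeff : B) ∉ P := by
    intro h
    have h1 := hmin _ p.leadingCoeff.2 h
    have h2 : E p = E p.eraseLead +
        p.leadingCoeff * ((fun y : B => y′)^[n] x) ^ p.natDegree := by
      conv_lhs => rw [← eraseLead_add_C_mul_X_pow p]
      rw [map_add, map_mul, map_pow, hE, derivEval_C, derivEval_X]
    have h3 : E p.eraseLead ∈ Q := by
      refine hpmin _ ?_ ?_
      · have := eraseLead_natDegree_le p
        omega
      · rw [h2] at hpP
        exact (Ideal.add_mem_iff_left _ (Ideal.mul_mem_right _ _ h)).1 hpP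
    rw [h2] at hpQ
    exact hpQ (add_mem h3 (Ideal.mul_mem_right _ _ h1))
  have hdeg : (derivative p).natDegree < p.natDegree := natDegree_derivative_lt hpos.ne'
  have hsep : E (derivative p) ∉ P := by
    intro h
    have h1 := hpmin _ hdeg h
    -- The top coefficients cancel, so `q` has smaller degree and falls into `Q`. Were the separant
    -- in `P`, and so in `Q`, then `deg p · E p` would be too, and characteristic zero gives `E p ∈
    -- Q`.
    set q := (p.natDegree : (derivSubring φ x n)[X]) * p - X * derivative p with hq
    have hEq : E q = p.natDegree * E p - (fun y : B => y′)^[n] x * E (derivative p) := by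
      rw [hq, map_sub, map_mul, map_mul, map_natCast, hE, derivEval_X]
    have hle : q.natDegree ≤ p.natDegree := by
      refine (natDegree_sub_le _ _).trans (max_le ?_ ?_)
      · rw [← C_eq_natCast]
        exact natDegree_C_mul_le _ _
      · refine natDegree_mul_le.trans ?_
        have := natDegree_X_le (R := derivSubring φ x n)
        omega
    have hcoeff : q.coeff p.natDegree = 0 := by
      obtain ⟨d, hd⟩ := Nat.exists_eq_succ_of_ne_zero hpos.ne'
      rw [hq, coeff_sub, hd, coeff_X_mul, coeff_derivative, ← C_eq_natCast, coeff_C_mul]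
      push_cast
      ring
    have hlt : q.natDegree < p.natDegree := by
      refine lt_of_le_of_ne hle fun heq => ?_
      have : q = 0 := by rw [← leadingCoeff_eq_zero, leadingCoeff, heq, hcoeff]
      rw [this, natDegree_zero] at heq
      omega
    have h2 : E q ∈ Q := by
      refine hpmin _ hlt ?_
      rw [hEq]
      exact sub_mem (Ideal.mul_mem_left _ _ hpP) (Ideal.mul_mem_left _ _ h)
    refine hpQ (Ideal.mem_of_natCast_mul_mem hpos.ne' ?_)
    rw [hEq] at h2
    have := add_mem h2 (Ideal.mul_mem_left Q ((fun y : B => y′)^[n] x) h1)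
    rwa [sub_add_cancel] at this
  have hIS : (p.leadingCoeff : B) * E (derivative p) ∉ P := fun h =>
    (hP.mem_or_mem h).elim hinit hsep
  have hfP : differentialIdeal {E p} ≤ P :=
    differentialIdeal_le (by simpa using hpP) hPrad.deriv_mem
  have hF' : ((insert (E p) (F.image φ) : Finset B) : Set B) ⊆ P := by
    rw [Finset.coe_insert, Set.insert_subset_iff]
    exact ⟨hpP, hFP⟩
  refine hP.false_of_mul_mem hIS hF' fun g hg => ?_
  set K := radicalDifferentialIdeal ((insert (E p) (F.image φ) : Finset B) : Set B) with hK
  have hQK : Q ≤ K := radicalDifferentialIdeal_mono (by simp)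
  have hfK : differentialIdeal {E p} ≤ K :=
    (differentialIdeal_mono (by simp)).trans (differentialIdeal_le_radicalDifferentialIdeal _)
  obtain ⟨N, hN⟩ := htop g
  -- Reduction has two stages: the separant removes derivatives of order above `n`, then
  -- pseudo-division lowers the degree in `x^(n)` below that of `p`. The final remainder is in `P`,
  -- hence in `Q` by minimality.
  obtain ⟨e, r, hr, h⟩ := exists_separant_pow_mul_sub_mem hφ p N hN
  rw [← hE] at h
  have hrP : r ∈ P := by
    have := sub_mem (P.mul_mem_left (E (derivative p) ^ e) hg) (hfP h)
    rwa [sub_sub_cancel] at this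
  obtain ⟨q, rfl⟩ := exists_derivEval_eq hr
  obtain ⟨e', r', hr', hdvd⟩ := exists_leadingCoeff_pow_mul_sub_dvd hpos q
  have h1 : (p.leadingCoeff : B) ^ e' * E q - E r' ∈ differentialIdeal {E p} := by
    obtain ⟨s, hs⟩ := hdvd
    have := congrArg E hs
    rw [map_sub, map_mul, map_pow, hE, derivEval_C, map_mul] at this
    rw [hE, this]
    exact Ideal.mul_mem_right _ _ (subset_differentialIdeal _ rfl)
  have hr'P : E r' ∈ P := by
    have := sub_mem (P.mul_mem_left ((p.leadingCoeff : B) ^ e') hrP) (hfP h1)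
    rwa [sub_sub_cancel] at this
  have hr'K : E r' ∈ K := hQK (hpmin _ hr' hr'P)
  have h2 : (p.leadingCoeff : B) ^ e' * E q ∈ K := by
    have := add_mem (hfK h1) hr'K
    rwa [sub_add_cancel] at this
  have h3 : (p.leadingCoeff : B) ^ e' * (E (derivative p) ^ e * g) ∈ K := by
    have := add_mem (K.mul_mem_left ((p.leadingCoeff : B) ^ e') (hfK h)) h2
    rwa [mul_sub, sub_add_cancel] at this
  -- This exponent is large enough for the power of initial times separant times `g` to be a
  -- multiple of the element in `h3`.
  refine (isRadicalDifferential_radicalDifferentialIdeal _).mem_of_pow_mem (n := e + e' + 1) ?_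
  convert K.mul_mem_left ((p.leadingCoeff : B) ^ (e + 1) * E (derivative p) ^ (e' + 1) *
    g ^ (e + e')) h3 using 1
  ring

end DifferentialExtension
/-! ## Ritt–Noetherianity of finitely generated free differential algebras -/

section FreeDifferential

variable {m : ℕ}

/-- The subalgebra of the free differential algebra generated by the derivatives of the `m_j(δ_i)`
with `(i, j) ∈ s`. -/
noncomputable def freeDiffSupported (m : ℕ) (s : Set (Fin m × ℕ+)) : Subalgebra ℂ (FreeDiffAlg m) :=
  MvPolynomial.supported ℂ {v | (v.1, v.2.1) ∈ s}

theorem freeDiffAlg_deriv_X (v : Fin m × ℕ+ × ℕ) :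
    (MvPolynomial.X v : FreeDiffAlg m)′ = MvPolynomial.X (v.1, v.2.1, v.2.2 + 1) :=
  MvPolynomial.mkDerivation_X _ _ _

theorem freeDiffAlg_deriv_C (c : ℂ) : (MvPolynomial.C c : FreeDiffAlg m)′ = 0 :=
  (freeDeriv m).map_algebraMap c

theorem iterate_freeDiffAlg_deriv_X (i : Fin m) (j : ℕ+) (α : ℕ) :
    (fun y : FreeDiffAlg m => y′)^[α] (MvPolynomial.X (i, j, 0)) = MvPolynomial.X (i, j, α) := by
  induction α with
  | zero => rfl
  | succ α ih => rw [Function.iterate_succ_apply', ih, freeDiffAlg_deriv_X]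

theorem deriv_mem_freeDiffSupported {s : Set (Fin m × ℕ+)} {x : FreeDiffAlg m}
    (hx : x ∈ freeDiffSupported m s) : x′ ∈ freeDiffSupported m s := by
  rw [freeDiffSupported, MvPolynomial.supported_eq_adjoin_X] at hx ⊢
  induction hx using Algebra.adjoin_induction with
  | mem x h =>
    obtain ⟨v, hv, rfl⟩ := h
    rw [freeDiffAlg_deriv_X]
    exact Algebra.subset_adjoin ⟨(v.1, v.2.1, v.2.2 + 1), hv, rfl⟩
  | algebraMap c =>
    rw [MvPolynomial.algebraMap_eq, freeDiffAlg_deriv_C]; exact zero_mem _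
  | add x y _ _ hx hy => rw [map_add]; exact add_mem hx hy
  | mul x y hx hy hx' hy' =>
    rw [Derivation.leibniz, smul_eq_mul, smul_eq_mul]
    exact add_mem (mul_mem hx hy') (mul_mem hy hx')

noncomputable instance (s : Set (Fin m × ℕ+)) : Differential (freeDiffSupported m s) where
  deriv := Derivation.mk'
    { toFun := fun x => ⟨(x : FreeDiffAlg m)′, deriv_mem_freeDiffSupported x.2⟩
      map_add' := fun x y => Subtype.ext (by simp)
      map_smul' := fun c x => Subtype.ext (by simp) }
    fun x y => Subtype.ext (by simp)

theorem freeDiffSupported_coe_iterate_deriv {s : Set (Fin m × ℕ+)} (x : freeDiffSupported m s)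
    (α : ℕ) : (((fun y : freeDiffSupported m s => y′)^[α] x : freeDiffSupported m s) :
      FreeDiffAlg m) = (fun y : FreeDiffAlg m => y′)^[α] x := by
  induction α with
  | zero => rfl
  | succ α ih => rw [Function.iterate_succ_apply', Function.iterate_succ_apply', ← ih]; rfl

/-- Induction on `s`: each new pair `(i, j)` adjoins the single differential generator `m_j(δ_i)`.
-/
theorem isRittNoetherian_freeDiffSupported (s : Finset (Fin m × ℕ+)) :
    IsRittNoetherian (freeDiffSupported m (s : Set (Fin m × ℕ+))) := by
  classical
  induction s using Finset.induction_on with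
  | empty =>
    have : IsNoetherianRing (freeDiffSupported m ((∅ : Finset (Fin m × ℕ+)) :
        Set (Fin m × ℕ+))) := by
      refine isNoetherianRing_of_surjective ℂ _ (algebraMap ℂ _) ?_
      rintro ⟨x, hx⟩
      have h : x ∈ (⊥ : Subalgebra ℂ (FreeDiffAlg m)) := by
        rw [← MvPolynomial.supported_empty]
        simpa [freeDiffSupported] using hx
      obtain ⟨c, rfl⟩ := Algebra.mem_bot.1 h
      exact ⟨c, rfl⟩
    exact isRittNoetherian_of_isNoetherianRing
  | insert a s _ ih =>
    have hle : freeDiffSupported m (s : Set (Fin m × ℕ+)) ≤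
        freeDiffSupported m ((insert a s : Finset (Fin m × ℕ+)) : Set (Fin m × ℕ+)) :=
      MvPolynomial.supported_mono fun v hv => by
        simp only [Set.mem_ofPred_eq, Finset.coe_insert, Set.mem_insert_iff] at hv ⊢
        exact Or.inr hv
    have ha : MvPolynomial.X (a.1, a.2, 0) ∈
        freeDiffSupported m ((insert a s : Finset (Fin m × ℕ+)) : Set (Fin m × ℕ+)) :=
      MvPolynomial.X_mem_supported.2 (by simp)
    refine ih.of_closure_eq_top (φ := (Subalgebra.inclusion hle).toRingHom)
      (x := ⟨_, ha⟩) (fun _ => rfl) ?_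
    rintro ⟨b, hb⟩
    have hb' := hb
    rw [freeDiffSupported, MvPolynomial.supported_eq_adjoin_X] at hb'
    suffices ∀ hb, ∃ N, (⟨b, hb⟩ : freeDiffSupported m ((insert a s : Finset (Fin m × ℕ+)) :
        Set (Fin m × ℕ+))) ∈ derivSubring (Subalgebra.inclusion hle).toRingHom ⟨_, ha⟩ N from
      this hb
    clear hb
    induction hb' using Algebra.adjoin_induction with
    | mem b h =>
      intro hb
      obtain ⟨v, hv, rfl⟩ := h
      simp only [Set.mem_ofPred_eq, Finset.coe_insert, Set.mem_insert_iff] at hv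
      obtain rfl | hv := hv
      · refine ⟨v.2.2 + 1, ?_⟩
        convert iterate_deriv_mem_derivSubring (Nat.lt_succ_self v.2.2) using 1
        refine Subtype.ext ?_
        rw [freeDiffSupported_coe_iterate_deriv]
        exact (iterate_freeDiffAlg_deriv_X _ _ _).symm
      · exact ⟨0, map_mem_derivSubring (φ := (Subalgebra.inclusion hle).toRingHom)
          ⟨MvPolynomial.X v, MvPolynomial.X_mem_supported.2 hv⟩⟩
    | algebraMap c =>
      exact fun _ => ⟨0, map_mem_derivSubring (φ := (Subalgebra.inclusion hle).toRingHom)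
        (algebraMap ℂ _ c)⟩
    | add x y hx hy ihx ihy =>
      intro hb
      rw [← MvPolynomial.supported_eq_adjoin_X] at hx hy
      obtain ⟨N, hN⟩ := ihx hx
      obtain ⟨N', hN'⟩ := ihy hy
      exact ⟨max N N', add_mem (derivSubring_mono (le_max_left _ _) hN)
        (derivSubring_mono (le_max_right _ _) hN')⟩
    | mul x y hx hy ihx ihy =>
      intro hb
      rw [← MvPolynomial.supported_eq_adjoin_X] at hx hy
      obtain ⟨N, hN⟩ := ihx hx
      obtain ⟨N', hN'⟩ := ihy hy
      have h := mul_mem (derivSubring_mono (le_max_left N N') hN)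
        (derivSubring_mono (le_max_right N N') hN')
      refine ⟨max N N', ?_⟩
      convert h using 1
      exact Subtype.ext (MulMemClass.coe_mul (S' := freeDiffSupported m _) ⟨x, hx⟩ ⟨y, hy⟩).symm

/-- The Ritt–Raudenbush basis theorem for the differential algebra `𝒜_k`. -/
theorem isRittNoetherian_freeDiffSubalg (m k : ℕ) : IsRittNoetherian (freeDiffSubalg m k) := by
  have hfin : {p : Fin m × ℕ+ | (p.2 : ℕ) ≤ k}.Finite := by
    refine Set.Finite.subset (Set.finite_univ.prod
      ((Set.finite_Iic k).preimage PNat.coe_injective.injOn)) fun p hp => ⟨trivial, hp⟩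
  have h := isRittNoetherian_freeDiffSupported hfin.toFinset
  rw [hfin.coe_toFinset] at h
  exact h

end FreeDifferential

/-! ## Formal series with restricted low-order coefficients -/

theorem seriesDeriv_X_pow_mul {R : Type*} [CommRing R] [Differential R] (i a : ℕ)
    (f : PowerSeries R) :
    seriesDeriv i (PowerSeries.X ^ a * f) = PowerSeries.X ^ a * seriesDeriv i f := by
  ext n
  simp only [seriesDeriv, PowerSeries.coeff_mk, PowerSeries.coeff_X_pow_mul']
  split_ifs
  · rfl
  · exact iterate_map_zero (Differential.deriv : Derivation ℤ R R) i

section CoeffsIn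

variable {R : Type*} [CommRing R] [Algebra ℚ R]

/-- The coefficients of order less than `N` of the series `f` lie in `M`. -/
def CoeffsIn (M : NonUnitalSubalgebra ℚ R) (N : ℕ) (f : PowerSeries R) : Prop :=
  ∀ j < N, PowerSeries.coeff j f ∈ M

variable {M : NonUnitalSubalgebra ℚ R} {N : ℕ} {f g : PowerSeries R}

/-- Divisibility by a power of `ε` is the case of the zero subalgebra, so one set of lemmas controls
both orders of vanishing and membership of coefficients. This, and the later use with ideals, is why
`M` has no unit. -/
theorem coeffsIn_bot_iff : CoeffsIn (⊥ : NonUnitalSubalgebra ℚ R) N f ↔ PowerSeries.X ^ N ∣ f := by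
  simp [CoeffsIn, PowerSeries.X_pow_dvd_iff, NonUnitalAlgebra.mem_bot]

namespace CoeffsIn

theorem mono {K : ℕ} (h : K ≤ N) (hf : CoeffsIn M N f) : CoeffsIn M K f :=
  fun j hj => hf j (hj.trans_le h)

theorem zero : CoeffsIn M N (0 : PowerSeries R) := fun j _ => by simp

theorem add (hf : CoeffsIn M N f) (hg : CoeffsIn M N g) : CoeffsIn M N (f + g) := fun j hj => by
  rw [map_add]; exact add_mem (hf j hj) (hg j hj)

theorem neg (hf : CoeffsIn M N f) : CoeffsIn M N (-f) := fun j hj => by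
  rw [map_neg, ← neg_one_smul ℚ]; exact M.smul_mem' _ (hf j hj)

theorem sub (hf : CoeffsIn M N f) (hg : CoeffsIn M N g) : CoeffsIn M N (f - g) := by
  rw [sub_eq_add_neg]; exact hf.add hg.neg

theorem mul (hf : CoeffsIn M N f) (hg : CoeffsIn M N g) : CoeffsIn M N (f * g) := by
  intro j hj
  rw [PowerSeries.coeff_mul]
  refine sum_mem fun p hp => ?_
  have := Finset.HasAntidiagonal.mem_antidiagonal.1 hp
  exact mul_mem (hf _ (by omega)) (hg _ (by omega))

theorem mul_pow (hf : CoeffsIn M N f) (hg : CoeffsIn M N g) (i : ℕ) : CoeffsIn M N (f * g ^ i) := by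
  -- The induction starts at `f`, since the constant series `g ^ 0 = 1` need not have coefficients
  -- in `M`.
  induction i with
  | zero => simpa using hf
  | succ i ih => rw [pow_succ, ← mul_assoc]; exact ih.mul hg

theorem X_pow_mul (hf : CoeffsIn M N f) (a : ℕ) :
    CoeffsIn M (N + a) (PowerSeries.X ^ a * f) := by
  intro j hj
  rw [PowerSeries.coeff_X_pow_mul']
  split_ifs with h
  · exact hf _ (by omega)
  · exact zero_mem _

theorem of_X_pow_mul {a : ℕ} (hf : CoeffsIn M (N + a) (PowerSeries.X ^ a * f)) :
    CoeffsIn M N f := by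
  intro j hj
  have := hf (j + a) (by omega)
  rwa [PowerSeries.coeff_X_pow_mul] at this

variable [Differential R]

theorem seriesDeriv (hM : ∀ x ∈ M, x′ ∈ M) (hf : CoeffsIn M N f) (i : ℕ) :
    CoeffsIn M N (seriesDeriv i f) := by
  intro j hj
  rw [_root_.seriesDeriv, PowerSeries.coeff_mk]
  induction i with
  | zero => exact hf j hj
  | succ i ih => rw [Function.iterate_succ_apply']; exact hM _ ih

theorem taylorComp (h : ∀ i, CoeffsIn M N (_root_.seriesDeriv i f * g ^ i)) :
    CoeffsIn M N (taylorComp f g) := by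
  intro j hj
  rw [_root_.taylorComp, PowerSeries.coeff_mk, taylorSum, map_sum]
  exact sum_mem fun i _ => by
    rw [PowerSeries.coeff_smul]
    exact M.smul_mem' _ (h i j hj)

theorem taylorComp_sub_self
    (h : ∀ i, CoeffsIn M N (_root_.seriesDeriv (i + 1) f * g ^ (i + 1))) :
    CoeffsIn M N (_root_.taylorComp f g - f) := by
  intro j hj
  rw [map_sub, _root_.taylorComp, PowerSeries.coeff_mk, taylorSum, Finset.sum_range_succ', map_add,
    map_sum, seriesDeriv_zero_left]
  simp only [Nat.factorial_zero, Nat.cast_one, inv_one, pow_zero, mul_one, one_smul,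
    add_sub_cancel_right]
  exact sum_mem fun i _ => by
    rw [PowerSeries.coeff_smul]
    exact M.smul_mem' _ (h i j hj)

end CoeffsIn

variable [Differential R]

/-- After the powers of `ε` are factored out, both cofactors have coefficients in `M` below order
`N`. Restoring them shifts the bound by the full order of the product, which is the gain behind the
commutator estimate. -/
theorem CoeffsIn.seriesDeriv_mul_pow (hM : ∀ x ∈ M, x′ ∈ M) {a b : ℕ}
    (hf : CoeffsIn M (N + a) f) (hg : CoeffsIn M (N + b) g) (hfa : PowerSeries.X ^ a ∣ f)
    (hgb : PowerSeries.X ^ b ∣ g) (i : ℕ) :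
    CoeffsIn M (N + (a + b * i)) (_root_.seriesDeriv i f * g ^ i) := by
  obtain ⟨f, rfl⟩ := hfa
  obtain ⟨g, rfl⟩ := hgb
  have := ((hf.of_X_pow_mul.seriesDeriv hM i).mul_pow hg.of_X_pow_mul i).X_pow_mul (a + b * i)
  rw [seriesDeriv_X_pow_mul]
  convert this using 1
  ring

namespace FormalDiffeo

/-- The group of formal series whose coefficients of order less than `N` lie in a differential
subalgebra, possibly without unit. -/
noncomputable def coeffSubgroup (M : NonUnitalSubalgebra ℚ R) (hM : ∀ x ∈ M, x′ ∈ M) (N : ℕ) :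
    Subgroup (FormalDiffeo R) where
  carrier := {F | CoeffsIn M N F.toSeries}
  mul_mem' {F G} hF hG := by
    change CoeffsIn M N _
    rw [toSeries_mul]
    exact hG.add (CoeffsIn.taylorComp fun i => (hF.seriesDeriv hM i).mul_pow hG i)
  one_mem' := CoeffsIn.zero
  inv_mem' {F} hF := by
    have h : ∀ n, CoeffsIn M N (leftInvApprox F.toSeries n) := by
      intro n
      induction n with
      | zero => exact CoeffsIn.zero
      | succ n ih =>
        exact ih.sub (hF.add (CoeffsIn.taylorComp fun i => (ih.seriesDeriv hM i).mul_pow hF i))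
    intro j hj
    change PowerSeries.coeff j (leftInv F.toSeries) ∈ M
    rw [leftInv, PowerSeries.coeff_mk]
    exact h _ j hj

theorem mem_coeffSubgroup {hM : ∀ x ∈ M, x′ ∈ M} {F : FormalDiffeo R} :
    F ∈ coeffSubgroup M hM N ↔ CoeffsIn M N F.toSeries :=
  Iff.rfl

/-- Write `⁅F, G⁆ = (F G)(G F)⁻¹` and subtract `(G F)(G F)⁻¹ = id`; composition on the right with a
fixed series is additive. -/
theorem toSeries_commutator (F G : FormalDiffeo R) :
    ⁅F, G⁆.toSeries =
      taylorComp ((F * G).toSeries - (G * F).toSeries) (G * F)⁻¹.toSeries := by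
  have h1 : ⁅F, G⁆ = (F * G) * (G * F)⁻¹ := by rw [commutatorElement_def]; group
  have h2 := congrArg toSeries (mul_inv_cancel (G * F))
  rw [toSeries_mul, toSeries_one] at h2
  rw [h1, toSeries_mul, taylorComp_sub]
  linear_combination h2

/-- The zeroth Taylor terms cancel in `F G - G F`. Every remaining term contains both series, so it
gains at least one order. -/
theorem coeffsIn_commutator (hM : ∀ x ∈ M, x′ ∈ M) {F G : FormalDiffeo R} {k l : ℕ} (hl : 1 ≤ l)
    (hF : CoeffsIn M (k + l) F.toSeries) (hFl : PowerSeries.X ^ l ∣ F.toSeries)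
    (hG : CoeffsIn M (k + 1) G.toSeries) : CoeffsIn M (k + (l + 1)) ⁅F, G⁆.toSeries := by
  have hX : ∀ F : FormalDiffeo R, PowerSeries.X ^ 1 ∣ F.toSeries := fun F => by
    simpa using F.X_dvd
  have hsub : (F * G).toSeries - (G * F).toSeries =
      (taylorComp F.toSeries G.toSeries - F.toSeries) -
        (taylorComp G.toSeries F.toSeries - G.toSeries) := by
    rw [toSeries_mul, toSeries_mul]; ring
  -- Needed twice: for `M` itself, and for the zero subalgebra, where it gives divisibility by `ε ^
  -- (l + 1)`.
  have hFG : ∀ (M' : NonUnitalSubalgebra ℚ R), (∀ x ∈ M', x′ ∈ M') → ∀ k',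
      CoeffsIn M' (k' + l) F.toSeries → CoeffsIn M' (k' + 1) G.toSeries →
      CoeffsIn M' (k' + (l + 1)) ((F * G).toSeries - (G * F).toSeries) := by
    intro M' hM' k' hF' hG'
    rw [hsub]
    refine (CoeffsIn.taylorComp_sub_self fun i => ?_).sub
      (CoeffsIn.taylorComp_sub_self fun i => ?_)
    · exact (hF'.seriesDeriv_mul_pow hM' hG' hFl (hX G) (i + 1)).mono (by omega)
    · exact (hG'.seriesDeriv_mul_pow hM' hF' (hX G) hFl (i + 1)).mono (by
        rw [mul_add]; omega)
  have hbot : ∀ x ∈ (⊥ : NonUnitalSubalgebra ℚ R), x′ ∈ (⊥ : NonUnitalSubalgebra ℚ R) := by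
    intro x hx
    rw [NonUnitalAlgebra.mem_bot] at hx ⊢
    rw [hx, map_zero]
  have hdvd : PowerSeries.X ^ (l + 1) ∣ (F * G).toSeries - (G * F).toSeries := by
    rw [← coeffsIn_bot_iff]
    refine (hFG ⊥ hbot 0 ?_ ?_).mono (by omega) <;> rw [coeffsIn_bot_iff, zero_add]
    · exact hFl
    · exact hX G
  have hinv : CoeffsIn M (k + 1) (G * F)⁻¹.toSeries :=
    (coeffSubgroup M hM (k + 1)).inv_mem ((coeffSubgroup M hM (k + 1)).mul_mem hG
      (hF.mono (by omega)))
  rw [toSeries_commutator]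
  exact CoeffsIn.taylorComp fun i =>
    ((hFG M hM k hF hG).seriesDeriv_mul_pow hM hinv hdvd (hX _) i).mono (by omega)

end FormalDiffeo

end CoeffsIn

/-! ### Functoriality of the group of formal series. -/

namespace FormalDiffeo

variable {R S : Type*} [CommRing R] [Differential R] [CommRing S] [Differential S]

theorem map_seriesDeriv (φ : R →+* S) (hφ : ∀ x, φ (x′) = (φ x)′) (i : ℕ) (f : PowerSeries R) :
    PowerSeries.map φ (seriesDeriv i f) = seriesDeriv i (PowerSeries.map φ f) := by
  ext n
  simp only [seriesDeriv, PowerSeries.coeff_map, PowerSeries.coeff_mk]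
  induction i with
  | zero => rfl
  | succ i ih => rw [Function.iterate_succ_apply', Function.iterate_succ_apply', hφ, ih]

variable [Algebra ℚ R] [Algebra ℚ S]

theorem map_taylorComp (φ : R →+* S) (hφ : ∀ x, φ (x′) = (φ x)′) (f g : PowerSeries R) :
    PowerSeries.map φ (taylorComp f g) =
      taylorComp (PowerSeries.map φ f) (PowerSeries.map φ g) := by
  have h : ∀ N, PowerSeries.map φ (taylorSum N f g) =
      taylorSum N (PowerSeries.map φ f) (PowerSeries.map φ g) := by
    intro N
    simp only [taylorSum, map_sum, map_rat_smul, map_mul, map_pow, map_seriesDeriv φ hφ]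
  ext n
  rw [PowerSeries.coeff_map, taylorComp, taylorComp, PowerSeries.coeff_mk, PowerSeries.coeff_mk,
    ← h, PowerSeries.coeff_map]

/-- The map on formal series induced by a differential ring homomorphism. -/
noncomputable def map (φ : R →+* S) (hφ : ∀ x, φ (x′) = (φ x)′) :
    FormalDiffeo R →* FormalDiffeo S :=
  MonoidHom.mk' (fun F => ⟨PowerSeries.map φ F.toSeries, by
      simpa using map_dvd (PowerSeries.map φ) F.X_dvd⟩) fun F G => by
    apply FormalDiffeo.ext
    refine (congrArg (PowerSeries.map φ) (toSeries_mul F G)).trans ?_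
    rw [map_add, map_taylorComp φ hφ]
    rfl

theorem toSeries_map (φ : R →+* S) (hφ : ∀ x, φ (x′) = (φ x)′) (F : FormalDiffeo R) :
    (map φ hφ F).toSeries = PowerSeries.map φ F.toSeries :=
  rfl

end FormalDiffeo
/-! ## Coefficients of the universal holonomy -/

section UniversalHolonomy

variable {G : Type*} [Group G] {m : ℕ}

/-- `𝒜_k` as a differential subalgebra over `ℚ`. -/
noncomputable def freeDiffRatSubalg (m k : ℕ) : NonUnitalSubalgebra ℚ (FreeDiffAlg m) :=
  ((freeDiffSubalg m k).restrictScalars ℚ).toNonUnitalSubalgebra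

theorem deriv_mem_freeDiffRatSubalg {k : ℕ} {x : FreeDiffAlg m}
    (hx : x ∈ freeDiffRatSubalg m k) : x′ ∈ freeDiffRatSubalg m k :=
  deriv_mem_freeDiffSubalg hx

/-- An ideal of `𝒜_k`, as a subalgebra of `𝒜` without unit. -/
noncomputable def idealSubalg {k : ℕ} (J : Ideal (freeDiffSubalg m k)) :
    NonUnitalSubalgebra ℚ (FreeDiffAlg m) where
  carrier := {x | ∃ y ∈ J, (y : FreeDiffAlg m) = x}
  add_mem' := by
    rintro _ _ ⟨x, hx, rfl⟩ ⟨y, hy, rfl⟩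
    exact ⟨x + y, add_mem hx hy, rfl⟩
  zero_mem' := ⟨0, zero_mem _, rfl⟩
  mul_mem' := by
    rintro _ _ ⟨x, hx, rfl⟩ ⟨y, hy, rfl⟩
    exact ⟨x * y, J.mul_mem_left _ hy, rfl⟩
  smul_mem' := by
    rintro c _ ⟨x, hx, rfl⟩
    refine ⟨algebraMap ℚ _ c * x, J.mul_mem_left _ hx, ?_⟩
    rw [Algebra.smul_def]
    rfl

theorem deriv_mem_idealSubalg {k : ℕ} {J : Ideal (freeDiffSubalg m k)} (hJ : ∀ x ∈ J, x′ ∈ J)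
    {x : FreeDiffAlg m} (hx : x ∈ idealSubalg J) : x′ ∈ idealSubalg J := by
  obtain ⟨y, hy, rfl⟩ := hx
  exact ⟨y′, hJ y hy, rfl⟩

theorem universalHolonomy_apply (δ : FreeGroupBasis (Fin m) G) (i : Fin m) :
    universalHolonomy δ (δ i) = universalSeries i := by
  simp [universalHolonomy]

theorem universalHolonomy_mem_of_forall (δ : FreeGroupBasis (Fin m) G)
    {K : Subgroup (FormalDiffeo (FreeDiffAlg m))} (hK : ∀ i, universalSeries i ∈ K) (g : G) :
    universalHolonomy δ g ∈ K := by
  have h : universalHolonomy δ = K.subtype.comp (δ.lift fun i => ⟨universalSeries i, hK i⟩) :=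
    δ.ext_hom _ _ fun i => by simp [universalHolonomy]
  rw [h]
  exact Subtype.prop _

/-- The series with coefficients in `𝒜_k` up to order `k` form a group, and the generators belong to
it. -/
theorem coeffsIn_universalHolonomy_one (δ : FreeGroupBasis (Fin m) G) (k : ℕ) (g : G) :
    CoeffsIn (freeDiffRatSubalg m k) (k + 1) (universalHolonomy δ g).toSeries := by
  refine universalHolonomy_mem_of_forall δ (K := FormalDiffeo.coeffSubgroup (freeDiffRatSubalg m k)
    (fun _ => deriv_mem_freeDiffRatSubalg) (k + 1)) (fun i j hj => ?_) g
  rw [universalSeries, PowerSeries.coeff_mk]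
  split_ifs with h
  · exact MvPolynomial.X_mem_supported.2 (show j ≤ k by omega)
  · exact zero_mem _

/-- The formal series in `coeffSubgroup M (k + l)` that are divisible by `ε ^ l`. -/
noncomputable def FormalDiffeo.filtration {R : Type*} [CommRing R] [Differential R] [Algebra ℚ R]
    (M : NonUnitalSubalgebra ℚ R) (hM : ∀ x ∈ M, x′ ∈ M) (k l : ℕ) : Subgroup (FormalDiffeo R) :=
  coeffSubgroup M hM (k + l) ⊓ coeffSubgroup ⊥ (fun x hx => by
    rw [NonUnitalAlgebra.mem_bot] at hx ⊢
    rw [hx, map_zero]) l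

theorem FormalDiffeo.mem_filtration {R : Type*} [CommRing R] [Differential R] [Algebra ℚ R]
    {M : NonUnitalSubalgebra ℚ R} {hM : ∀ x ∈ M, x′ ∈ M} {k l : ℕ} {F : FormalDiffeo R} :
    F ∈ filtration M hM k l ↔ CoeffsIn M (k + l) F.toSeries ∧ PowerSeries.X ^ l ∣ F.toSeries := by
  rw [filtration, Subgroup.mem_inf, mem_coeffSubgroup, mem_coeffSubgroup, coeffsIn_bot_iff]

/-- Along the lower central series each commutator raises both bounds, `k + l` and `l`, by one. -/
theorem universalHolonomy_mem_filtration (δ : FreeGroupBasis (Fin m) G) (k : ℕ) {l : ℕ}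
    (hl : 1 ≤ l) {g : G} (hg : g ∈ lowerCentral G l) :
    universalHolonomy δ g ∈ FormalDiffeo.filtration (freeDiffRatSubalg m k)
      (fun _ => deriv_mem_freeDiffRatSubalg) k l := by
  obtain ⟨i, rfl⟩ := Nat.exists_eq_add_of_le' hl
  suffices (⊤ : Subgroup G).lowerCentralSeries i ≤ (FormalDiffeo.filtration
      (freeDiffRatSubalg m k) (fun _ => deriv_mem_freeDiffRatSubalg) k (i + 1)).comap
        (universalHolonomy δ) from this hg
  clear hg hl
  induction i with
  | zero =>
    intro g _
    exact FormalDiffeo.mem_filtration.2 ⟨coeffsIn_universalHolonomy_one δ k g, by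
      simpa using (universalHolonomy δ g).X_dvd⟩
  | succ i ih =>
    rw [Subgroup.lowerCentralSeries_succ, Subgroup.commutator_le]
    intro g hg h _
    obtain ⟨h1, h2⟩ := FormalDiffeo.mem_filtration.1 (ih hg)
    rw [Subgroup.mem_comap, map_commutatorElement, FormalDiffeo.mem_filtration]
    refine ⟨FormalDiffeo.coeffsIn_commutator (fun _ => deriv_mem_freeDiffRatSubalg) (by omega) h1 h2
      (coeffsIn_universalHolonomy_one δ k h), ?_⟩
    rw [← coeffsIn_bot_iff]
    refine (FormalDiffeo.coeffsIn_commutator (k := 0) (l := i + 1) (fun x hx => ?_) (by omega)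
      ?_ h2 ?_).mono (by omega)
    · rw [NonUnitalAlgebra.mem_bot] at hx ⊢
      rw [hx, map_zero]
    · rwa [coeffsIn_bot_iff, zero_add]
    · rw [coeffsIn_bot_iff]
      simpa using (universalHolonomy δ h).X_dvd

theorem universalMelnikov_mem_freeDiffSubalg (δ : FreeGroupBasis (Fin m) G) {k l : ℕ}
    (hl : 1 ≤ l) {g : G} (hg : g ∈ lowerCentral G l) {j : ℕ} (hj : j ≤ l + k - 1) :
    universalMelnikov δ j g ∈ freeDiffSubalg m k :=
  (FormalDiffeo.mem_filtration.1 (universalHolonomy_mem_filtration δ k hl hg)).1 j (by omega)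

theorem universalMelnikov_eq_zero (δ : FreeGroupBasis (Fin m) G) {l : ℕ}
    (hl : 1 ≤ l) {g : G} (hg : g ∈ lowerCentral G l) {j : ℕ} (hj : j < l) :
    universalMelnikov δ j g = 0 :=
  PowerSeries.X_pow_dvd_iff.1
    (FormalDiffeo.mem_filtration.1 (universalHolonomy_mem_filtration δ 0 hl hg)).2 j hj

end UniversalHolonomy

/-! ## Change of free generators -/

section ChangeOfBasis

variable {G : Type*} [Group G] {m m' : ℕ}

/-- The differential algebra homomorphism that sends `m_j(δ_i)` to the component `m_j` of the
universal holonomy of `δ_i` with respect to another free basis. -/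
noncomputable def changeBasis (δ : FreeGroupBasis (Fin m) G) (δ' : FreeGroupBasis (Fin m') G) :
    FreeDiffAlg m →ₐ[ℂ] FreeDiffAlg m' :=
  MvPolynomial.aeval fun v => (fun y : FreeDiffAlg m' => y′)^[v.2.2]
    (universalMelnikov δ' v.2.1 (δ v.1))

variable (δ : FreeGroupBasis (Fin m) G) (δ' : FreeGroupBasis (Fin m') G)

theorem changeBasis_X (v : Fin m × ℕ+ × ℕ) : changeBasis δ δ' (MvPolynomial.X v) =
    (fun y : FreeDiffAlg m' => y′)^[v.2.2] (universalMelnikov δ' v.2.1 (δ v.1)) :=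
  MvPolynomial.aeval_X _ _

theorem changeBasis_deriv (x : FreeDiffAlg m) :
    changeBasis δ δ' (x′) = (changeBasis δ δ' x)′ := by
  induction x using MvPolynomial.induction_on with
  | C c =>
    rw [freeDiffAlg_deriv_C, map_zero, ← MvPolynomial.algebraMap_eq, AlgHom.commutes,
      MvPolynomial.algebraMap_eq, freeDiffAlg_deriv_C]
  | add p q hp hq => simp only [map_add, hp, hq]
  | mul_X p v hp =>
    rw [Derivation.leibniz, map_mul, Derivation.leibniz, freeDiffAlg_deriv_X]
    simp only [smul_eq_mul, map_add, map_mul, hp, changeBasis_X, Function.iterate_succ_apply']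

/-- Both sides are homomorphisms in `g`, and they agree on the basis `δ` by the choice of
`changeBasis`. -/
theorem map_universalHolonomy (g : G) :
    FormalDiffeo.map (changeBasis δ δ').toRingHom (changeBasis_deriv δ δ')
      (universalHolonomy δ g) = universalHolonomy δ' g := by
  suffices (FormalDiffeo.map (changeBasis δ δ').toRingHom (changeBasis_deriv δ δ')).comp
      (universalHolonomy δ) = universalHolonomy δ' from DFunLike.congr_fun this g
  refine δ.ext_hom _ _ fun i => FormalDiffeo.ext (PowerSeries.ext fun j => ?_)
  rw [MonoidHom.comp_apply, universalHolonomy_apply, FormalDiffeo.toSeries_map,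
    PowerSeries.coeff_map, universalSeries, PowerSeries.coeff_mk]
  split_ifs with h
  · exact changeBasis_X δ δ' _
  · rw [map_zero]
    obtain rfl : j = 0 := by omega
    exact ((PowerSeries.X_pow_dvd_iff (n := 1)).1
      (by simpa using (universalHolonomy δ' (δ i)).X_dvd) 0 one_pos).symm

theorem changeBasis_universalMelnikov (j : ℕ) (g : G) :
    changeBasis δ δ' (universalMelnikov δ j g) = universalMelnikov δ' j g := by
  rw [universalMelnikov, universalMelnikov, ← map_universalHolonomy δ δ' g,
    FormalDiffeo.toSeries_map, PowerSeries.coeff_map]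
  rfl

theorem changeBasis_mem_freeDiffSubalg {k : ℕ} {x : FreeDiffAlg m} (hx : x ∈ freeDiffSubalg m k) :
    changeBasis δ δ' x ∈ freeDiffSubalg m' k := by
  rw [freeDiffSubalg, MvPolynomial.supported_eq_adjoin_X] at hx
  induction hx using Algebra.adjoin_induction with
  | mem x h =>
    obtain ⟨v, hv, rfl⟩ := h
    rw [changeBasis_X]
    have hv : (v.2.1 : ℕ) ≤ k := hv
    induction v.2.2 with
    | zero => exact coeffsIn_universalHolonomy_one δ' k _ _ (by omega)
    | succ α ih => rw [Function.iterate_succ_apply']; exact deriv_mem_freeDiffSubalg ih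
  | algebraMap c => rw [AlgHom.commutes]; exact algebraMap_mem _ c
  | add x y _ _ hx hy => rw [map_add]; exact add_mem hx hy
  | mul x y _ _ hx hy => rw [map_mul]; exact mul_mem hx hy

/-- The restriction of `changeBasis` to `𝒜_k`. -/
noncomputable def changeBasisRestrict (k : ℕ) : freeDiffSubalg m k →+* freeDiffSubalg m' k :=
  ((changeBasis δ δ').toRingHom.comp (freeDiffSubalg m k).val.toRingHom).codRestrict
    (freeDiffSubalg m' k) fun x => changeBasis_mem_freeDiffSubalg δ δ' x.2

theorem coe_changeBasisRestrict {k : ℕ} (x : freeDiffSubalg m k) :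
    (changeBasisRestrict δ δ' k x : FreeDiffAlg m') = changeBasis δ δ' x :=
  rfl

theorem changeBasisRestrict_deriv {k : ℕ} (x : freeDiffSubalg m k) :
    changeBasisRestrict δ δ' k (x′) = (changeBasisRestrict δ δ' k x)′ :=
  Subtype.ext (changeBasis_deriv δ δ' x)

end ChangeOfBasis

/-! ## The differential ideals of a subgroup -/

section MelnikovSet

variable {G : Type*} [Group G] {m m' : ℕ}

/-- The elements `m_j(g)` of `𝒜_k` with `g ∈ 𝒪 ∩ L_q` and `q ≤ j ≤ q + k - 1`, for `q ≤ n`. -/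
def melnikovSet (δ : FreeGroupBasis (Fin m) G) (𝒪 : Subgroup G) (k n : ℕ) :
    Set (freeDiffSubalg m k) :=
  {x | ∃ q, ∃ g ∈ 𝒪 ⊓ lowerCentral G q, ∃ j, 1 ≤ q ∧ q ≤ n ∧ q ≤ j ∧ j ≤ q + k - 1 ∧
    (x : FreeDiffAlg m) = universalMelnikov δ j g}

theorem melnikovSet_mono (δ : FreeGroupBasis (Fin m) G) (𝒪 : Subgroup G) (k : ℕ) :
    Monotone (melnikovSet δ 𝒪 k) := by
  rintro n n' h x ⟨q, g, hg, j, h1, h2, h3⟩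
  exact ⟨q, g, hg, j, h1, h2.trans h, h3⟩

theorem changeBasisRestrict_mem_melnikovSet (δ : FreeGroupBasis (Fin m) G)
    (δ' : FreeGroupBasis (Fin m') G) {𝒪 : Subgroup G} {k n : ℕ} {x : freeDiffSubalg m k}
    (hx : x ∈ melnikovSet δ 𝒪 k n) : changeBasisRestrict δ δ' k x ∈ melnikovSet δ' 𝒪 k n := by
  obtain ⟨q, g, hg, j, h1, h2, h3, h4, h⟩ := hx
  refine ⟨q, g, hg, j, h1, h2, h3, h4, ?_⟩
  rw [coe_changeBasisRestrict, h, changeBasis_universalMelnikov]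

/-- Ritt–Raudenbush applies to the union over all `n`. Finitely many elements of the union suffice
to generate, and they lie in one member of the increasing family. -/
theorem exists_melnikovSet_subset (δ : FreeGroupBasis (Fin m) G) (𝒪 : Subgroup G) (k : ℕ) :
    ∃ n, ∀ n', melnikovSet δ 𝒪 k n' ⊆ radicalDifferentialIdeal (melnikovSet δ 𝒪 k n) := by
  obtain ⟨F, hF⟩ := isRittNoetherian_freeDiffSubalg m k
    (radicalDifferentialIdeal (⋃ n, melnikovSet δ 𝒪 k n))
    (isRadicalDifferential_radicalDifferentialIdeal _)
  obtain ⟨E, hE, hFE⟩ := exists_finset_subset_radicalDifferentialIdeal F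
    (S := ⋃ n, melnikovSet δ 𝒪 k n) (hF ▸ subset_radicalDifferentialIdeal _)
  obtain ⟨n, hn⟩ := (melnikovSet_mono δ 𝒪 k).directed_le.exists_mem_subset_of_finset_subset_biUnion
    hE
  refine ⟨n, fun n' => ?_⟩
  have h1 : radicalDifferentialIdeal (⋃ n, melnikovSet δ 𝒪 k n) ≤
      radicalDifferentialIdeal (melnikovSet δ 𝒪 k n) := by
    rw [hF]
    exact (isRadicalDifferential_radicalDifferentialIdeal _).radicalDifferentialIdeal_le
      (hFE.trans (radicalDifferentialIdeal_mono hn))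
  exact (Set.subset_iUnion _ n').trans ((subset_radicalDifferentialIdeal _).trans h1)

/-- The bound `n` works for all free bases simultaneously. -/
theorem exists_forall_melnikovSet_subset (𝒪 : Subgroup G) (k : ℕ) :
    ∃ n, ∀ (m : ℕ) (δ : FreeGroupBasis (Fin m) G) (n' : ℕ),
      melnikovSet δ 𝒪 k n' ⊆ radicalDifferentialIdeal (melnikovSet δ 𝒪 k n) := by
  by_cases h : ∃ m, Nonempty (FreeGroupBasis (Fin m) G)
  -- The bound of one fixed basis is carried to every other by the differential homomorphism
  -- `changeBasisRestrict`.
  · obtain ⟨m, ⟨δ⟩⟩ := h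
    obtain ⟨n, hn⟩ := exists_melnikovSet_subset δ 𝒪 k
    refine ⟨n, fun m' δ' n' => ?_⟩
    rintro x ⟨q, g, hg, j, h1, h2, h3, h4, hx⟩
    have hmem := universalMelnikov_mem_freeDiffSubalg δ (k := k) h1 hg.2 h4
    have hle : radicalDifferentialIdeal (melnikovSet δ 𝒪 k n) ≤
        (radicalDifferentialIdeal (melnikovSet δ' 𝒪 k n)).comap (changeBasisRestrict δ δ' k) :=
      ((isRadicalDifferential_radicalDifferentialIdeal _).comap _
        (changeBasisRestrict_deriv δ δ')).radicalDifferentialIdeal_le fun y hy =>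
          subset_radicalDifferentialIdeal _ (changeBasisRestrict_mem_melnikovSet δ δ' hy)
    have h5 := hle (hn n' (show (⟨universalMelnikov δ j g, hmem⟩ : freeDiffSubalg m k) ∈
      melnikovSet δ 𝒪 k n' from ⟨q, g, hg, j, h1, h2, h3, h4, rfl⟩))
    rw [Ideal.mem_comap] at h5
    have hx' : x = changeBasisRestrict δ δ' k ⟨universalMelnikov δ j g, hmem⟩ :=
      Subtype.ext (by rw [hx, coe_changeBasisRestrict, changeBasis_universalMelnikov])
    rw [hx']
    exact h5
  · exact ⟨0, fun m δ => (h ⟨m, ⟨δ⟩⟩).elim⟩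

/-- The generators of the quotients `(𝒪 ∩ L_q) / (𝒪 ∩ L_{q + 1})` with `q ≤ n + k` already generate
a differential ideal containing all `m_j(g)` with `g ∈ 𝒪 ∩ L_q`, `q ≤ n` and `j ≤ q + k - 1`. -/
theorem melnikovSet_subset_differentialIdeal (δ : FreeGroupBasis (Fin m) G) {𝒪 : Subgroup G}
    {d : ℕ → ℕ} {σ : (q : ℕ) → Fin (d q) → G}
    (hσ : ∀ q, 1 ≤ q → Subgroup.closure (Set.range (σ q)) ⊔ (𝒪 ⊓ lowerCentral G (q + 1)) =
      𝒪 ⊓ lowerCentral G q) (k n : ℕ) :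
    melnikovSet δ 𝒪 k n ⊆ differentialIdeal {x : freeDiffSubalg m k |
      ∃ (q j' : ℕ) (q' : Fin (d q)), 1 ≤ q ∧ q ≤ n + k ∧ q ≤ j' ∧ j' ≤ q + k - 1 ∧
        (x : FreeDiffAlg m) = universalMelnikov δ j' (σ q q')} := by
  set T := {x : freeDiffSubalg m k | ∃ (q j' : ℕ) (q' : Fin (d q)), 1 ≤ q ∧ q ≤ n + k ∧ q ≤ j' ∧
    j' ≤ q + k - 1 ∧ (x : FreeDiffAlg m) = universalMelnikov δ j' (σ q q')} with hT
  have hJ : ∀ x ∈ idealSubalg (differentialIdeal T), x′ ∈ idealSubalg (differentialIdeal T) :=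
    fun _ => deriv_mem_idealSubalg fun _ => deriv_mem_differentialIdeal
  -- Descending induction on `q`, with `i` bounding the distance to `n + k`. For `q ≥ n + k` all
  -- coefficients of order below `n + k` vanish; the minimum keeps the bound from exceeding this
  -- range.
  have key : ∀ i q, 1 ≤ q → n + k ≤ q + i → ∀ g ∈ 𝒪 ⊓ lowerCentral G q,
      CoeffsIn (idealSubalg (differentialIdeal T)) (min (q + k) (n + k))
        (universalHolonomy δ g).toSeries := by
    intro i
    induction i with
    | zero =>
      intro q hq hi g hg j hj
      have := universalMelnikov_eq_zero δ hq hg.2 (j := j) (by omega)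
      rw [universalMelnikov] at this
      rw [this]
      exact zero_mem _
    | succ i ih =>
      intro q hq hi g hg
      obtain h | h := Nat.lt_or_ge (n + k) q
      · exact ih q hq (by omega) g hg
      -- The admissible elements form a subgroup, so it is enough to treat the `σ q q'` and `𝒪 ∩
      -- L_{q+1}`.
      suffices 𝒪 ⊓ lowerCentral G q ≤ (FormalDiffeo.coeffSubgroup _ hJ
          (min (q + k) (n + k))).comap (universalHolonomy δ) from this hg
      rw [← hσ q hq, sup_le_iff, Subgroup.closure_le]
      refine ⟨?_, fun g hg => (ih (q + 1) (by omega) (by omega) g hg).mono (by omega)⟩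
      rintro _ ⟨q', rfl⟩ j hj
      have hmem : σ q q' ∈ 𝒪 ⊓ lowerCentral G q := by
        rw [← hσ q hq]
        exact Subgroup.mem_sup_left (Subgroup.subset_closure ⟨q', rfl⟩)
      obtain hjq | hjq := lt_or_ge j q
      · have := universalMelnikov_eq_zero δ hq hmem.2 hjq
        rw [universalMelnikov] at this
        rw [this]
        exact zero_mem _
      · have hj' : j ≤ q + k - 1 := by omega
        exact ⟨⟨_, universalMelnikov_mem_freeDiffSubalg δ hq hmem.2 hj'⟩,
          subset_differentialIdeal _ ⟨q, j, q', hq, h, hjq, hj', rfl⟩, rfl⟩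
  rintro x ⟨q, g, hg, j, h1, h2, h3, h4, hx⟩
  obtain ⟨y, hy, hyx⟩ := key (n + k) q h1 (by omega) g hg j (by omega)
  rwa [show x = y from Subtype.ext (hx.trans hyx.symm)]

theorem exists_forall_universalMelnikov_pow_mem (𝒪 : Subgroup G) (k : ℕ) :
    ∃ n : ℕ, ∀ (m : ℕ) (δ : FreeGroupBasis (Fin m) G) (d : ℕ → ℕ) (σ : (q : ℕ) → Fin (d q) → G),
      (∀ q, 1 ≤ q → Subgroup.closure (Set.range (σ q)) ⊔ (𝒪 ⊓ lowerCentral G (q + 1)) =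
        𝒪 ⊓ lowerCentral G q) →
      ∀ (l : ℕ), ∀ g ∈ 𝒪 ⊓ lowerCentral G l, ∀ j : ℕ, 1 ≤ j → j ≤ l + k - 1 →
        ∃ hg : universalMelnikov δ j g ∈ freeDiffSubalg m k, ∃ e : ℕ, 1 ≤ e ∧
          (⟨universalMelnikov δ j g, hg⟩ : freeDiffSubalg m k) ^ e ∈
            differentialIdeal {x : freeDiffSubalg m k | ∃ (q j' : ℕ) (q' : Fin (d q)),
              1 ≤ q ∧ q ≤ n ∧ q ≤ j' ∧ j' ≤ q + k - 1 ∧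
              (x : FreeDiffAlg m) = universalMelnikov δ j' (σ q q')} := by
  obtain ⟨n, hn⟩ := exists_forall_melnikovSet_subset 𝒪 k
  refine ⟨n + k, fun m δ d σ hσ l g hg j hj1 hj => ?_⟩
  -- As `L_0 = L_1`, the case `l = 0` is absorbed by `l = 1`, which allows a larger range of `j`.
  obtain ⟨l, hl, hg, hj⟩ : ∃ l, 1 ≤ l ∧ g ∈ 𝒪 ⊓ lowerCentral G l ∧ j ≤ l + k - 1 := by
    obtain rfl | hl := Nat.eq_zero_or_pos l
    · exact ⟨1, le_rfl, hg, by omega⟩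
    · exact ⟨l, hl, hg, hj⟩
  have hmem := universalMelnikov_mem_freeDiffSubalg δ hl hg.2 hj
  refine ⟨hmem, ?_⟩
  obtain h | h := lt_or_ge j l
  · refine ⟨1, le_rfl, ?_⟩
    have h0 : (⟨universalMelnikov δ j g, hmem⟩ : freeDiffSubalg m k) = 0 :=
      Subtype.ext (universalMelnikov_eq_zero δ hl hg.2 h)
    rw [h0, pow_one]
    exact zero_mem _
  · have h1 := hn m δ l (show (⟨universalMelnikov δ j g, hmem⟩ : freeDiffSubalg m k) ∈
      melnikovSet δ 𝒪 k l from ⟨l, g, hg, j, hl, le_rfl, h, hj, rfl⟩)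
    have h2 := (isRadicalDifferential_radicalDifferentialIdeal _).radicalDifferentialIdeal_le
      ((melnikovSet_subset_differentialIdeal δ hσ k n).trans
        (differentialIdeal_le_radicalDifferentialIdeal _)) h1
    obtain ⟨e, he⟩ := h2
    -- The exponent coming from the radical may be `0`, so it is increased by one.
    exact ⟨e + 1, by omega, by rw [pow_succ]; exact Ideal.mul_mem_right _ _ he⟩

end MelnikovSet

theorem theoremA (H : MvPolynomial (Fin 2) ℂ) (t₀ : ℂ) (ht₀ : t₀ ∉ atypicalValues H)
    (p₀ : fiber H t₀) (γ : Path p₀ p₀) (k : ℕ) :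
    ∃ n : ℕ, ∀ (m : ℕ) (δ : FreeGroupBasis (Fin m) (FundamentalGroup (fiber H t₀) p₀))
      (d : ℕ → ℕ) (σ : (q : ℕ) → Fin (d q) → FundamentalGroup (fiber H t₀) p₀),
      (∀ q, 1 ≤ q → Subgroup.closure (Set.range (σ q)) ⊔ (orbitSubgroup γ ⊓ lowerCentral _ (q + 1)) =
        orbitSubgroup γ ⊓ lowerCentral _ q) →
      ∀ (l : ℕ), ∀ g ∈ orbitSubgroup γ ⊓ lowerCentral _ l, ∀ j : ℕ, 1 ≤ j → j ≤ l + k - 1 →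
        ∃ hg : universalMelnikov δ j g ∈ freeDiffSubalg m k, ∃ e : ℕ, 1 ≤ e ∧
          (⟨universalMelnikov δ j g, hg⟩ : freeDiffSubalg m k) ^ e ∈
            differentialIdeal {x : freeDiffSubalg m k | ∃ (q j' : ℕ) (q' : Fin (d q)),
              1 ≤ q ∧ q ≤ n ∧ q ≤ j' ∧ j' ≤ q + k - 1 ∧
              (x : FreeDiffAlg m) = universalMelnikov δ j' (σ q q')} := by
  exact exists_forall_universalMelnikov_pow_mem (orbitSubgroup γ) k
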